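/- Let $N,M$ be positive integers, let $\mathbb F_q$ be a finite field of order $q$, let $H$ be a vector space over $\mathbb F_q$ of dimension $N+M$, and fix an $M$-dimensional subspace $h\subseteq H$. Let $P$ be the set of subspaces $x\subseteq H$ with $x\cap h=0$, partially ordered by inclusion, and let $P_i$ be the set of elements of $P$ of dimension $i$ $(0\le i\le N)$. In $\mathrm{Mat}_P(\mathbb C)$, let $L$ have $(x,y)$-entry $1$ if $y$ covers $x$ and $0$ otherwise; let $R$ have $(x,y)$-entry $1$ if $x$ covers $y$ and $0$ otherwise; let $F_i$ be the diagonal matrix with $(y,y)$-entry $1$ if $y\in P_i$ and $0$ otherwise; and let $K=\sum_{i=0}^N q^{N+M-i}F_i$. Let $T$ be the (unital) subalgebra of $\mathrm{Mat}_P(\mathbb C)$ generated by $R,L,K,K^{-1}$, and let $Z(T)$ be its center. A $T$-module means a $T$-submodule of $\mathbb CP$, the space of column vectors indexed by $P$. The type of an irreducible $T$-module $W$ is the pair $(r,d)$, where $r=\min\{i : 0\le i\le N,\ F_iW\neq 0\}$ (the endpoint) and $d=|\{i: 0\le i\le N,\ F_iW\ne 0\}|-1$ (the diameter). Define $$C_1=q^{-1}(q-1)^{-1}(q+1)K+RL-q^{-1}LR,\qquad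 C_2=K^2+(q-1)RLK-(q-1)LRK .$$ Then: 1. $C_1$ and $C_2$ belong to $Z(T)$, and the algebra $Z(T)$ is generated by $C_1,C_2$. 2. On every irreducible $T$-module of type $(r,d)$, $C_1$ acts as the scalar $(q-1)^{-1}q^{N+M-r}(1+q^{-d-1})$ and $C_2$ acts as the scalar $q^{2N+2M-2r-d}$. 3. These scalars separate the types: two irreducible $T$-modules $W,W'$ of types $(r,d)$ and $(r',d')$ satisfy $(r,d)=(r',d')$ if and only if $(q-1)^{-1}q^{N+M-r}(1+q^{-d-1})=(q-1)^{-1}q^{N+M-r'}(1+q^{-d'-1})$ and $q^{2N+2M-2r-d}=q^{2N+2M-2r'-d'}$. Moreover $W$ and $W'$ are isomorphic as $T$-modules if and only if $(r,d)=(r',d')$. -/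

import Mathlib

open scoped Matrix Matrix.Module

noncomputable section

/-- The attenuated space poset attached to a subspace `h` of `H`: the subspaces of `H` whose
intersection with `h` is zero, ordered by inclusion. -/
def AttenuatedSpace {F H : Type*} [Field F] [AddCommGroup H] [Module F H]
    (h : Submodule F H) : Type _ :=
  {x : Submodule F H // x ⊓ h = ⊥}

namespace AttenuatedSpace

variable {F H : Type*} [Field F] [AddCommGroup H] [Module F H]

instance (h : Submodule F H) : PartialOrder (AttenuatedSpace h) :=
  inferInstanceAs (PartialOrder {x : Submodule F H // x ⊓ h = ⊥})

instance (h : Submodule F H) : DecidableEq (AttenuatedSpace h) :=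
  Classical.decEq _

instance [Finite F] [FiniteDimensional F H] (h : Submodule F H) :
    Finite (AttenuatedSpace h) :=
  have : Finite H := Module.finite_of_finite F
  have : Finite (Submodule F H) := Finite.of_injective _ SetLike.coe_injective
  inferInstanceAs (Finite {x : Submodule F H // x ⊓ h = ⊥})

instance [Finite F] [FiniteDimensional F H] (h : Submodule F H) :
    Fintype (AttenuatedSpace h) :=
  Fintype.ofFinite _

/-- The dimension of an element of the poset; `x` lies in `P_i` when `dim x = i`. -/
def dim {h : Submodule F H} (x : AttenuatedSpace h) : ℕ :=
  Module.finrank F x.1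

/-- `q`, the order of the finite field, as a complex number. -/
def q (F : Type*) : ℂ :=
  (Nat.card F : ℂ)

variable (h : Submodule F H)

open Classical in
/-- The lowering matrix: the `(x, y)`-entry is `1` if `y` covers `x`, and `0` otherwise. -/
def L : Matrix (AttenuatedSpace h) (AttenuatedSpace h) ℂ :=
  Matrix.of fun x y => if x ⋖ y then 1 else 0

open Classical in
/-- The raising matrix: the `(x, y)`-entry is `1` if `x` covers `y`, and `0` otherwise. -/
def R : Matrix (AttenuatedSpace h) (AttenuatedSpace h) ℂ :=
  Matrix.of fun x y => if y ⋖ x then 1 else 0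

/-- The `i`-th projection matrix `F_i`. -/
def proj (i : ℕ) : Matrix (AttenuatedSpace h) (AttenuatedSpace h) ℂ :=
  Matrix.diagonal fun y => if dim y = i then 1 else 0

/-- The diagonal matrix `K = ∑_{i=0}^N q^{N+M-i} F_i`. -/
def K (N M : ℕ) : Matrix (AttenuatedSpace h) (AttenuatedSpace h) ℂ :=
  ∑ i ∈ Finset.range (N + 1), (q F) ^ ((N : ℤ) + M - i) • proj h i

variable [Finite F] [FiniteDimensional F H]

/-- The incidence algebra `T`: the subalgebra of `Mat_P(ℂ)` generated by `R, L, K, K⁻¹`. -/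
def T (N M : ℕ) : Subalgebra ℂ (Matrix (AttenuatedSpace h) (AttenuatedSpace h) ℂ) :=
  Algebra.adjoin ℂ {R h, L h, K h N M, (K h N M)⁻¹}

/-- The center `Z(T)`, viewed as a subalgebra of `Mat_P(ℂ)`. -/
def centerT (N M : ℕ) : Subalgebra ℂ (Matrix (AttenuatedSpace h) (AttenuatedSpace h) ℂ) :=
  (Subalgebra.center ℂ (T h N M)).map (T h N M).val

/-- `C₁ = q⁻¹ (q-1)⁻¹ (q+1) K + R L - q⁻¹ L R`. -/
def C₁ (N M : ℕ) : Matrix (AttenuatedSpace h) (AttenuatedSpace h) ℂ :=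
  ((q F)⁻¹ * (q F - 1)⁻¹ * (q F + 1)) • K h N M + R h * L h - (q F)⁻¹ • (L h * R h)

/-- `C₂ = K² + (q-1) R L K - (q-1) L R K`. -/
def C₂ (N M : ℕ) : Matrix (AttenuatedSpace h) (AttenuatedSpace h) ℂ :=
  (K h N M) ^ 2 + (q F - 1) • (R h * L h * K h N M) - (q F - 1) • (L h * R h * K h N M)

variable {h}

/-- The support `{i | 0 ≤ i ≤ N, F_i W ≠ 0}` of a `T`-submodule `W` of `ℂP`. Here `ℂP` is the
space of column vectors `AttenuatedSpace h → ℂ`, on which matrices act by multiplication. -/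
def support {N M : ℕ} (W : Submodule (T h N M) (AttenuatedSpace h → ℂ)) : Set ℕ :=
  {i | i ≤ N ∧ ∃ w ∈ W, proj h i *ᵥ w ≠ 0}

/-- The endpoint `min {i | 0 ≤ i ≤ N, F_i W ≠ 0}` (meaningful for `W ≠ 0`). -/
def endpoint {N M : ℕ} (W : Submodule (T h N M) (AttenuatedSpace h → ℂ)) : ℕ :=
  sInf (support W)

/-- The diameter `|{i | 0 ≤ i ≤ N, F_i W ≠ 0}| - 1` (meaningful for `W ≠ 0`). -/
def diameter {N M : ℕ} (W : Submodule (T h N M) (AttenuatedSpace h → ℂ)) : ℕ :=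
  (support W).ncard - 1

/-- The type `(r, d)` of `W`: its endpoint and its diameter. -/
def type {N M : ℕ} (W : Submodule (T h N M) (AttenuatedSpace h → ℂ)) : ℕ × ℕ :=
  (endpoint W, diameter W)

/-- The scalar `(q-1)⁻¹ q^{N+M-r} (1 + q^{-d-1})` attached to `t = (r, d)`. -/
def scalar₁ (F : Type*) (N M : ℕ) (t : ℕ × ℕ) : ℂ :=
  (q F - 1)⁻¹ * (q F) ^ ((N : ℤ) + M - t.1) * (1 + (q F) ^ (-(t.2 : ℤ) - 1))

/-- The scalar `q^{2N+2M-2r-d}` attached to `t = (r, d)`. -/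
def scalar₂ (F : Type*) (N M : ℕ) (t : ℕ × ℕ) : ℂ :=
  (q F) ^ (2 * (N : ℤ) + 2 * M - 2 * t.1 - t.2)

end AttenuatedSpace

end

/-! Everything rests on one identity, `L_relation`: `q R L² - (q+1) L R L + L² R = -(q+1) L K`. It
is checked entrywise by counting covers, and `K` enters because the number of covers drops by
`q^{N+M-i}` from level `i-1` to level `i`. With `K L = q L K`, the identity makes `C₁` and `C₂`
commute with `L`; transposition gives `R`, and commuting with `K` is a matter of degree.

On a simple module `C₁` is a scalar `c` by Schur. For a homogeneous `v` with `L v = 0`, the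
definition of `C₁` determines `L R^{k+1} v` recursively as a multiple of `R^k v` (`L_mulVec_raise`),
so the string `R^k v` spans the module. If `R^d v` is its last nonzero vector, the coefficient at
`d+1` vanishes, which fixes `c`; evaluating `C₂` on `v` gives its scalar (`exists_string`). Up to
constant factors the two scalars are the sum and product of `q^{N+M-r}` and `q^{N+M-r-d-1}`, hence
they determine `(r,d)`. The type determines the action on the string, hence the annihilator of `v`
and the isomorphism class.

`T` is closed under conjugate transpose, so the standard module is semisimple and a matrix is
determined by its action on simple submodules. A central element acts by a scalar depending only on
the type; since the scalars of `C₁` and `C₂` separate the finitely many types, interpolation writes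
it as a polynomial in them. -/

noncomputable section

namespace AttenuatedSpace

section

variable {F H : Type*} [Field F] [AddCommGroup H] [Module F H]

/-! ### Covers in the poset -/

section Poset

variable {h : Submodule F H}

theorem le_def {x y : AttenuatedSpace h} : x ≤ y ↔ x.1 ≤ y.1 := Iff.rfl

/-- A subspace of an element of the poset, as an element of the poset. -/
def ofLE (y : AttenuatedSpace h) (x : Submodule F H) (hx : x ≤ y.1) : AttenuatedSpace h :=
  ⟨x, eq_bot_iff.2 ((inf_le_inf_right h hx).trans y.2.le)⟩

variable [FiniteDimensional F H]

theorem dim_mono {x y : AttenuatedSpace h} (hxy : x ≤ y) : dim x ≤ dim y :=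
  Submodule.finrank_mono hxy

theorem eq_of_le_of_dim_le {x y : AttenuatedSpace h} (hxy : x ≤ y) (hd : dim y ≤ dim x) :
    x = y :=
  Subtype.ext (Submodule.eq_of_le_of_finrank_le hxy hd)

theorem finrank_sup_span_singleton {x : Submodule F H} {v : H} (hv : v ∉ x) :
    Module.finrank F ↥(x ⊔ F ∙ v) = Module.finrank F x + 1 := by
  have hv0 : v ≠ 0 := fun h0 => hv (h0 ▸ x.zero_mem)
  have hd : x ⊓ F ∙ v = ⊥ := ((Submodule.disjoint_span_singleton' hv0).2 hv).eq_bot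
  have h1 := Submodule.finrank_sup_add_finrank_inf_eq x (F ∙ v)
  rw [hd, finrank_bot, finrank_span_singleton hv0] at h1
  exact h1

/-- The poset is closed under passing to subspaces, so adjoining to `x` one vector of `y` stays
inside it and no cover can skip a dimension. -/
theorem covBy_iff {x y : AttenuatedSpace h} : x ⋖ y ↔ x ≤ y ∧ dim y = dim x + 1 := by
  constructor
  · intro hxy
    refine ⟨hxy.le, ?_⟩
    obtain ⟨v, hvy, hvx⟩ := SetLike.exists_of_lt (show x.1 < y.1 from hxy.lt)
    have hle : x.1 ⊔ F ∙ v ≤ y.1 :=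
      sup_le hxy.le ((Submodule.span_singleton_le_iff_mem v y.1).2 hvy)
    have hd := finrank_sup_span_singleton hvx
    have hlt : x < ofLE y _ hle := by
      refine lt_of_le_of_ne (show x.1 ≤ x.1 ⊔ F ∙ v from le_sup_left) fun he => ?_
      have : dim x = dim x + 1 := (congrArg dim he).trans hd
      omega
    have he : ofLE y _ hle = y := (hxy.eq_or_eq hlt.le hle).resolve_left hlt.ne'
    exact (congrArg dim he).symm.trans hd
  · rintro ⟨hle, hd⟩
    refine ⟨lt_of_le_of_ne hle (by rintro rfl; omega), fun z hxz hzy => ?_⟩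
    have h1 : dim x < dim z := Submodule.finrank_lt_finrank_of_lt hxz
    have h2 : dim z < dim y := Submodule.finrank_lt_finrank_of_lt hzy
    omega

end Poset

/-! ### Counting covers -/

open Classical in
theorem card_filter_mem [FiniteDimensional F H] [Fintype H] (S : Submodule F H) :
    (Finset.univ.filter (· ∈ S)).card = Nat.card F ^ Module.finrank F S := by
  rw [← Module.natCard_eq_pow_finrank (K := F) (V := S), Nat.card_eq_fintype_card,
    Fintype.card_subtype]

variable [Finite F] [FiniteDimensional F H]

open Classical in
/-- The number of elements of the poset that cover `x` and lie inside the subspace `S`. -/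
def upCount {h : Submodule F H} (x : AttenuatedSpace h) (S : Submodule F H) : ℕ :=
  (Finset.univ.filter fun w : AttenuatedSpace h => x ⋖ w ∧ w.1 ≤ S).card

open Classical in
/-- The number of elements of the poset that `y` covers. -/
def downCount {h : Submodule F H} (y : AttenuatedSpace h) : ℕ :=
  (Finset.univ.filter fun z : AttenuatedSpace h => z ⋖ y).card

variable {h : Submodule F H}

/-- A vector `v` of `S` spans with `x` a cover of `x` in the poset exactly when `v` avoids `x ⊕ (S ∩
h)`. The vectors of `S` outside this sum are thus partitioned into the sets `w \ x`, all of the same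
size. -/
theorem upCount_mul_add (x : AttenuatedSpace h) {S : Submodule F H} (hxS : x.1 ≤ S) :
    upCount x S * (Nat.card F ^ (dim x + 1) - Nat.card F ^ dim x) +
      Nat.card F ^ (dim x + Module.finrank F ↥(S ⊓ h)) = Nat.card F ^ Module.finrank F S := by
  classical
  have : Finite H := Module.finite_of_finite F
  have : Fintype H := Fintype.ofFinite H
  set S' := x.1 ⊔ (S ⊓ h) with hS'
  have hS'S : S' ≤ S := sup_le hxS inf_le_left
  have hfin : Module.finrank F S' = dim x + Module.finrank F ↥(S ⊓ h) := by
    have h1 := Submodule.finrank_sup_add_finrank_inf_eq x.1 (S ⊓ h)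
    have h2 : x.1 ⊓ (S ⊓ h) = ⊥ :=
      eq_bot_iff.2 ((inf_le_inf_left _ inf_le_right).trans x.2.le)
    rw [h2, finrank_bot] at h1
    exact h1
  have hunion : (Finset.univ.filter (· ∈ S)) \ (Finset.univ.filter (· ∈ S')) =
      (Finset.univ.filter fun w : AttenuatedSpace h => x ⋖ w ∧ w.1 ≤ S).biUnion
        fun w => (Finset.univ.filter (· ∈ w.1)) \ (Finset.univ.filter (· ∈ x.1)) := by
    ext v
    simp only [Finset.mem_sdiff, Finset.mem_filter, Finset.mem_univ, true_and, Finset.mem_biUnion]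
    constructor
    · rintro ⟨hvS, hvS'⟩
      have hvx : v ∉ x.1 := fun hv => hvS' (Submodule.mem_sup_left hv)
      have hle : x.1 ⊔ F ∙ v ≤ S :=
        sup_le hxS ((Submodule.span_singleton_le_iff_mem v S).2 hvS)
      have hP : (x.1 ⊔ F ∙ v) ⊓ h = ⊥ := by
        rw [Submodule.eq_bot_iff]
        rintro u ⟨hu, huh⟩
        obtain ⟨a, ha, b, hb, rfl⟩ := Submodule.mem_sup.1 hu
        obtain ⟨c, rfl⟩ := Submodule.mem_span_singleton.1 hb
        by_cases hc : c = 0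
        · subst hc
          rw [zero_smul, add_zero] at huh ⊢
          exact (Submodule.eq_bot_iff _).1 x.2 a ⟨ha, huh⟩
        · exfalso
          apply hvS'
          have hcv : c • v ∈ S' := by
            have h1 : a + c • v ∈ S' := Submodule.mem_sup_right
              ⟨S.add_mem (hxS ha) (S.smul_mem c hvS), huh⟩
            have h2 : a ∈ S' := Submodule.mem_sup_left ha
            simpa using S'.sub_mem h1 h2
          exact (S'.smul_mem_iff hc).1 hcv
      exact ⟨⟨_, hP⟩, ⟨covBy_iff.2 ⟨show x.1 ≤ x.1 ⊔ F ∙ v from le_sup_left,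
        finrank_sup_span_singleton hvx⟩, hle⟩,
        Submodule.mem_sup_right (Submodule.mem_span_singleton_self v), hvx⟩
    · rintro ⟨w, ⟨hxw, hwS⟩, hvw, hvx⟩
      refine ⟨hwS hvw, fun hv => hvx ?_⟩
      obtain ⟨a, ha, b, hb, rfl⟩ := Submodule.mem_sup.1 hv
      have hbw : b ∈ w.1 := by simpa using w.1.sub_mem hvw (hxw.le ha)
      rw [(Submodule.eq_bot_iff _).1 w.2 b ⟨hbw, hb.2⟩, add_zero]
      exact ha
  have hdisj : ∀ w ∈ (Finset.univ.filter fun w : AttenuatedSpace h => x ⋖ w ∧ w.1 ≤ S),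
      ∀ w' ∈ (Finset.univ.filter fun w : AttenuatedSpace h => x ⋖ w ∧ w.1 ≤ S), w ≠ w' →
      Disjoint ((Finset.univ.filter (· ∈ w.1)) \ (Finset.univ.filter (· ∈ x.1)))
        ((Finset.univ.filter (· ∈ w'.1)) \ (Finset.univ.filter (· ∈ x.1))) := by
    intro w hw w' hw' hne
    rw [Finset.disjoint_left]
    intro v hv hv'
    simp only [Finset.mem_sdiff, Finset.mem_filter, Finset.mem_univ, true_and] at hw hw' hv hv'
    apply hne
    have key : ∀ z : AttenuatedSpace h, x ⋖ z → v ∈ z.1 → x.1 ⊔ F ∙ v = z.1 := by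
      intro z hz hvz
      refine Submodule.eq_of_le_of_finrank_eq
        (sup_le hz.le ((Submodule.span_singleton_le_iff_mem v z.1).2 hvz)) ?_
      rw [finrank_sup_span_singleton hv.2]
      exact (covBy_iff.1 hz).2.symm
    exact Subtype.ext ((key w hw.1 hv.1).symm.trans (key w' hw'.1 hv'.1))
  have hcard := congrArg Finset.card hunion
  rw [Finset.card_biUnion hdisj, Finset.card_sdiff_of_subset
    (Finset.monotone_filter_right _ fun _ _ hv => hS'S hv), card_filter_mem, card_filter_mem,
    hfin, Finset.sum_congr rfl (g := fun _ => Nat.card F ^ (dim x + 1) - Nat.card F ^ dim x),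
    Finset.sum_const, smul_eq_mul] at hcard
  · have hle : Nat.card F ^ (dim x + Module.finrank F ↥(S ⊓ h)) ≤
        Nat.card F ^ Module.finrank F S :=
      Nat.pow_le_pow_right Nat.card_pos (hfin ▸ Submodule.finrank_mono hS'S)
    unfold upCount
    omega
  · intro w hw
    simp only [Finset.mem_filter, Finset.mem_univ, true_and] at hw
    rw [Finset.card_sdiff_of_subset (Finset.monotone_filter_right _ fun _ _ hv => hw.1.le hv),
      card_filter_mem, card_filter_mem]
    congr 2
    exact (covBy_iff.1 hw.1).2

theorem q_ne_zero : q F ≠ 0 := Nat.cast_ne_zero.2 Nat.card_pos.ne'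

theorem one_lt_natCard : 1 < Nat.card F := Finite.one_lt_card

theorem q_ne_one : q F ≠ 1 := Nat.cast_ne_one.2 (one_lt_natCard (F := F)).ne'

theorem q_zpow_injective : Function.Injective fun n : ℤ => q F ^ n := by
  intro m n hmn
  have hq : (1 : ℝ) < Nat.card F := by exact_mod_cast one_lt_natCard (F := F)
  have hcast : ∀ n : ℤ, q F ^ n = (((Nat.card F : ℝ) ^ n : ℝ) : ℂ) := fun n => by
    rw [Complex.ofReal_zpow, Complex.ofReal_natCast, q]
  simp only [hcast, Complex.ofReal_inj] at hmn
  exact zpow_right_injective₀ (by linarith) hq.ne' hmn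

omit [Field F] [Finite F] in
theorem q_add_one_ne_zero : q F + 1 ≠ 0 := Nat.cast_add_one_ne_zero _

theorem upCount_mul (x : AttenuatedSpace h) {S : Submodule F H} (hxS : x.1 ≤ S) :
    (upCount x S : ℂ) * (q F ^ (dim x) * (q F - 1)) =
      q F ^ Module.finrank F S - q F ^ (dim x + Module.finrank F ↥(S ⊓ h)) := by
  have h1 := upCount_mul_add x hxS
  have hle : Nat.card F ^ dim x ≤ Nat.card F ^ (dim x + 1) :=
    Nat.pow_le_pow_right Nat.card_pos (Nat.le_succ _)
  have h2 := congrArg (Nat.cast : ℕ → ℂ) h1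
  push_cast [Nat.cast_sub hle] at h2
  unfold q
  rw [← h2]
  ring

/-- An interval of length two in the poset has `q + 1` elements in the middle. -/
theorem upCount_eq_of_dim_eq {x y : AttenuatedSpace h} (hxy : x ≤ y) (hd : dim y = dim x + 2) :
    (upCount x y.1 : ℂ) = q F + 1 := by
  have h1 := upCount_mul x hxy
  rw [y.2, finrank_bot, add_zero] at h1
  have hq : q F ^ dim x * (q F - 1) ≠ 0 :=
    mul_ne_zero (pow_ne_zero _ q_ne_zero) (sub_ne_zero.2 q_ne_one)
  apply mul_right_cancel₀ hq
  rw [h1, show Module.finrank F y.1 = dim x + 2 from hd]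
  ring

/-- This difference is where the diagonal entries of `K` come from. -/
theorem upCount_top_sub {N M : ℕ} (hH : Module.finrank F H = N + M)
    (hh : Module.finrank F h = M) {x y : AttenuatedSpace h} (hd : dim y = dim x + 1) :
    (upCount x ⊤ : ℂ) - upCount y ⊤ = q F ^ ((N : ℤ) + M - dim y) := by
  have h1 := upCount_mul x (le_top (a := x.1))
  have h2 := upCount_mul y (le_top (a := y.1))
  rw [finrank_top, hH, top_inf_eq, hh] at h1 h2
  have hq : q F ≠ 0 := q_ne_zero
  have hq1 : q F - 1 ≠ 0 := sub_ne_zero.2 q_ne_one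
  rw [zpow_sub₀ hq, ← Nat.cast_add, zpow_natCast, zpow_natCast, eq_div_iff (pow_ne_zero _ hq)]
  apply mul_right_cancel₀ hq1
  rw [hd] at h2 ⊢
  linear_combination q F * h1 - h2

end

/-! ### Entries of the products of `L` and `R` -/

section

variable {F H : Type*} [Field F] [AddCommGroup H] [Module F H] {h : Submodule F H}

theorem transpose_L (h : Submodule F H) : (L h)ᵀ = R h := rfl

theorem transpose_R (h : Submodule F H) : (R h)ᵀ = L h := rfl

theorem K_eq_diagonal {N M : ℕ} (hN : ∀ x : AttenuatedSpace h, dim x ≤ N) :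
    K h N M = Matrix.diagonal fun x => q F ^ ((N : ℤ) + M - dim x) := by
  ext x y
  simp only [K, Matrix.sum_apply, Matrix.smul_apply, proj, smul_eq_mul, Matrix.diagonal_apply]
  by_cases hxy : x = y
  · subst hxy
    simp only [if_true, mul_ite, mul_one, mul_zero]
    rw [Finset.sum_ite_eq, if_pos (Finset.mem_range.2 (Nat.lt_succ_of_le (hN x)))]
  · simp [hxy]

/-- The intersection of two elements of the poset. -/
def meet (x y : AttenuatedSpace h) : AttenuatedSpace h := ofLE x (x.1 ⊓ y.1) inf_le_left

theorem meet_le_left (x y : AttenuatedSpace h) : meet x y ≤ x := inf_le_left (a := x.1)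

theorem meet_le_right (x y : AttenuatedSpace h) : meet x y ≤ y := inf_le_right (a := x.1)

theorem le_meet {x y z : AttenuatedSpace h} (hx : z ≤ x) (hy : z ≤ y) : z ≤ meet x y :=
  le_inf (le_def.1 hx) (le_def.1 hy)

variable [FiniteDimensional F H]

theorem finrank_sup_add_dim_meet (x y : AttenuatedSpace h) :
    Module.finrank F ↥(x.1 ⊔ y.1) + dim (meet x y) = dim x + dim y :=
  Submodule.finrank_sup_add_finrank_inf_eq x.1 y.1

theorem dim_lt_finrank_sup {x y : AttenuatedSpace h} (hxy : ¬ x ≤ y) :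
    dim y < Module.finrank F ↥(x.1 ⊔ y.1) :=
  Submodule.finrank_lt_finrank_of_lt (right_lt_sup.2 hxy)

theorem finrank_sup_le {x y z : AttenuatedSpace h} (hx : x ≤ z) (hy : y ≤ z) :
    Module.finrank F ↥(x.1 ⊔ y.1) ≤ dim z :=
  Submodule.finrank_mono (sup_le (le_def.1 hx) (le_def.1 hy))

theorem not_le_of_ne_of_dim_le {x y : AttenuatedSpace h} (hne : x ≠ y) (hd : dim y ≤ dim x) :
    ¬ x ≤ y := fun hle => hne (eq_of_le_of_dim_le hle hd)

theorem meet_covBy_left {x y z : AttenuatedSpace h} (hx : x ⋖ y) (hz : z ⋖ y) (hne : x ≠ z) :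
    meet x z ⋖ x := by
  rw [covBy_iff] at *
  have h1 := finrank_sup_add_dim_meet x z
  have h2 := dim_lt_finrank_sup (not_le_of_ne_of_dim_le hne (by omega))
  have h3 := finrank_sup_le hx.1 hz.1
  exact ⟨meet_le_left _ _, by omega⟩

theorem dim_le {N M : ℕ} (hH : Module.finrank F H = N + M) (hh : Module.finrank F h = M)
    (x : AttenuatedSpace h) : dim x ≤ N := by
  have h1 := Submodule.finrank_sup_add_finrank_inf_eq x.1 h
  have h2 := Submodule.finrank_le (x.1 ⊔ h)
  rw [x.2, finrank_bot] at h1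
  have : Module.finrank F x.1 = dim x := rfl
  omega

variable [Finite F]

open Classical in
/-- The number of elements of the poset covered by both arguments. -/
def commonCount (w y : AttenuatedSpace h) : ℕ :=
  (Finset.univ.filter fun z : AttenuatedSpace h => z ⋖ w ∧ z ⋖ y).card

theorem commonCount_self (y : AttenuatedSpace h) : commonCount y y = downCount y := by
  unfold commonCount downCount
  congr 1
  ext z
  simp

open Classical in
-- Anything covered by both lies in `w ∩ y`, so by dimension it must be `w ∩ y`; this has
-- codimension one exactly when the sum has one extra dimension.
theorem commonCount_of_ne {w y : AttenuatedSpace h} (hne : w ≠ y) (hd : dim w = dim y) :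
    commonCount w y = if Module.finrank F ↥(w.1 ⊔ y.1) = dim y + 1 then 1 else 0 := by
  have h1 := finrank_sup_add_dim_meet w y
  have h2 := dim_lt_finrank_sup (not_le_of_ne_of_dim_le hne hd.ge)
  unfold commonCount
  split_ifs with hs
  · rw [Finset.card_eq_one]
    refine ⟨meet w y, ?_⟩
    ext z
    simp only [Finset.mem_filter, Finset.mem_univ, true_and, Finset.mem_singleton, covBy_iff]
    constructor
    · rintro ⟨hw, hy⟩
      exact eq_of_le_of_dim_le (le_meet hw.1 hy.1) (by omega)
    · rintro rfl
      exact ⟨⟨meet_le_left _ _, by omega⟩, ⟨meet_le_right _ _, by omega⟩⟩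
  · rw [Finset.card_eq_zero, Finset.filter_eq_empty_iff]
    rintro z - ⟨hw, hy⟩
    rw [covBy_iff] at hw hy
    have h3 := dim_mono (le_meet hw.1 hy.1)
    omega

open Classical in
-- Send each `z ≠ x` covered by `y` to `x ∩ z`. The fibre over `u` is the middle of the interval
-- from `u` to `y` with `x` removed, so it has `q` elements.
theorem downCount_eq {x y : AttenuatedSpace h} (hxy : x ⋖ y) :
    (downCount y : ℂ) = q F * downCount x + 1 := by
  have hmaps : Set.MapsTo (fun z => meet x z)
      ((Finset.univ.filter fun z : AttenuatedSpace h => z ⋖ y).erase x : Set (AttenuatedSpace h))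
      (Finset.univ.filter fun u : AttenuatedSpace h => u ⋖ x) := by
    intro z hz
    simp only [Finset.coe_erase, Finset.coe_filter, Finset.mem_univ, true_and, Set.mem_sdiff,
      Set.mem_ofPred_eq, Set.mem_singleton_iff] at hz ⊢
    exact meet_covBy_left hxy hz.1 (Ne.symm hz.2)
  have hcard := Finset.card_eq_sum_card_fiberwise hmaps
  have hfib : ∀ u ∈ (Finset.univ.filter fun u : AttenuatedSpace h => u ⋖ x),
      ((((Finset.univ.filter fun z : AttenuatedSpace h => z ⋖ y).erase x).filter
        fun z => meet x z = u).card : ℂ) = q F := by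
    intro u hu
    simp only [Finset.mem_filter, Finset.mem_univ, true_and] at hu
    have hd : dim y = dim u + 2 := by
      rw [(covBy_iff.1 hxy).2, (covBy_iff.1 hu).2]
    have heq : (((Finset.univ.filter fun z : AttenuatedSpace h => z ⋖ y).erase x).filter
        fun z => meet x z = u) =
        (Finset.univ.filter fun w : AttenuatedSpace h => u ⋖ w ∧ w.1 ≤ y.1).erase x := by
      ext z
      simp only [Finset.mem_filter, Finset.mem_erase, Finset.mem_univ, true_and]
      constructor
      · rintro ⟨⟨hne, hz⟩, rfl⟩
        refine ⟨hne, ?_, hz.le⟩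
        rw [covBy_iff] at *
        exact ⟨meet_le_right _ _, by omega⟩
      · rintro ⟨hne, hz, hle⟩
        have hzy : z ⋖ y := covBy_iff.2 ⟨hle, by rw [hd, (covBy_iff.1 hz).2]⟩
        refine ⟨⟨hne, hzy⟩, (eq_of_le_of_dim_le (le_meet hu.le hz.le) ?_).symm⟩
        have h1 := (covBy_iff.1 (meet_covBy_left hxy hzy hne.symm)).2
        have h2 := (covBy_iff.1 hu).2
        omega
    have h1 := upCount_eq_of_dim_eq (hu.le.trans hxy.le) hd
    rw [heq, Finset.cast_card_erase_of_mem]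
    · change (upCount u y.1 : ℂ) - 1 = _
      rw [h1]; ring
    · simpa using ⟨hu, hxy.le⟩
  have hc := congrArg (Nat.cast : ℕ → ℂ) hcard
  rw [Nat.cast_sum, Finset.sum_congr rfl hfib, Finset.sum_const,
    Finset.cast_card_erase_of_mem (by simpa using hxy), nsmul_eq_mul] at hc
  unfold downCount
  linear_combination hc

variable (h)

open Classical in
/-- The matrix of pairs `x ≤ y` with `dim y = dim x + 2`. -/
def twoStep : Matrix (AttenuatedSpace h) (AttenuatedSpace h) ℂ :=
  Matrix.of fun x y => if x ≤ y ∧ dim y = dim x + 2 then 1 else 0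

theorem L_mul_L : L h * L h = (q F + 1) • twoStep h := by
  classical
  ext x y
  simp only [Matrix.mul_apply, L, twoStep, Matrix.of_apply, Matrix.smul_apply, smul_eq_mul,
    mul_ite, mul_one, mul_zero, ← ite_and, Finset.sum_boole]
  split_ifs with hxy
  · rw [← upCount_eq_of_dim_eq hxy.1 hxy.2]
    unfold upCount
    congr 2
    ext z
    simp only [Finset.mem_filter, Finset.mem_univ, true_and]
    constructor
    · rintro ⟨h1, h2⟩
      exact ⟨h2, h1.le⟩
    · rintro ⟨h1, h2⟩
      exact ⟨covBy_iff.2 ⟨h2, by rw [hxy.2, (covBy_iff.1 h1).2]⟩, h1⟩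
  · rw [Nat.cast_eq_zero, Finset.card_eq_zero, Finset.filter_eq_empty_iff]
    rintro z - ⟨h1, h2⟩
    rw [covBy_iff] at h1 h2
    exact hxy ⟨h2.1.trans h1.1, by omega⟩

open Classical in
theorem R_mul_twoStep_apply (x y : AttenuatedSpace h) : (R h * twoStep h) x y =
    ((Finset.univ.filter fun z : AttenuatedSpace h =>
      z ⋖ x ∧ z ≤ y ∧ dim y = dim z + 2).card : ℂ) := by
  simp only [Matrix.mul_apply, R, twoStep, Matrix.of_apply, mul_ite, mul_one, mul_zero,
    ← ite_and, Finset.sum_boole]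
  congr 2
  ext z
  simp only [Finset.mem_filter, Finset.mem_univ, true_and]
  tauto

open Classical in
theorem twoStep_mul_R_apply (x y : AttenuatedSpace h) : (twoStep h * R h) x y =
    ((Finset.univ.filter fun w : AttenuatedSpace h =>
      y ⋖ w ∧ x ≤ w ∧ dim w = dim x + 2).card : ℂ) := by
  simp only [Matrix.mul_apply, R, twoStep, Matrix.of_apply, mul_ite, mul_one, mul_zero,
    ← ite_and, Finset.sum_boole]

open Classical in
theorem L_mul_R_mul_L_apply (x y : AttenuatedSpace h) : (L h * R h * L h) x y =
    ∑ w ∈ Finset.univ.filter (fun w : AttenuatedSpace h => x ⋖ w), (commonCount w y : ℂ) := by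
  rw [mul_assoc, Matrix.mul_apply, Finset.sum_filter]
  refine Finset.sum_congr rfl fun w _ => ?_
  simp only [Matrix.mul_apply, L, R, Matrix.of_apply, mul_ite, mul_one, mul_zero, ite_mul,
    one_mul, zero_mul, ← ite_and, Finset.sum_boole, commonCount]
  split_ifs
  · congr 2
    ext z
    simp only [Finset.mem_filter, Finset.mem_univ, true_and]
    tauto
  · rfl

variable {h}

theorem R_mul_twoStep_apply_of_covBy {x y : AttenuatedSpace h} (hxy : x ⋖ y) :
    (R h * twoStep h) x y = downCount x := by
  classical
  rw [R_mul_twoStep_apply]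
  unfold downCount
  congr 2
  ext z
  simp only [Finset.mem_filter, Finset.mem_univ, true_and, and_iff_left_iff_imp]
  intro hz
  exact ⟨hz.le.trans hxy.le, by rw [(covBy_iff.1 hxy).2, (covBy_iff.1 hz).2]⟩

theorem twoStep_mul_R_apply_of_covBy {x y : AttenuatedSpace h} (hxy : x ⋖ y) :
    (twoStep h * R h) x y = upCount y ⊤ := by
  classical
  rw [twoStep_mul_R_apply]
  unfold upCount
  congr 2
  ext w
  simp only [Finset.mem_filter, Finset.mem_univ, true_and, le_top, and_true,
    and_iff_left_iff_imp]
  intro hw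
  exact ⟨hxy.le.trans hw.le, by rw [(covBy_iff.1 hw).2, (covBy_iff.1 hxy).2]⟩

/-- Among the covers `w` of `x`, the term `w = y` gives `downCount y`, and every other one shares
exactly `x` with `y`. -/
theorem L_mul_R_mul_L_apply_of_covBy {x y : AttenuatedSpace h} (hxy : x ⋖ y) :
    (L h * R h * L h) x y = downCount y + upCount x ⊤ - 1 := by
  classical
  rw [L_mul_R_mul_L_apply, ← Finset.add_sum_erase _ _ (a := y) (by simpa using hxy),
    commonCount_self, Finset.sum_congr rfl (g := fun _ => (1 : ℂ)), Finset.sum_const,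
    Finset.card_erase_of_mem (by simpa using hxy), nsmul_eq_mul, mul_one, Nat.cast_pred]
  · simp only [upCount, le_top, and_true]
    ring
  · exact Finset.card_pos.2 ⟨y, by simpa using hxy⟩
  · intro w hw
    simp only [Finset.mem_erase, Finset.mem_filter, Finset.mem_univ, true_and] at hw
    have hd : dim w = dim y := by rw [(covBy_iff.1 hw.2).2, (covBy_iff.1 hxy).2]
    have hpos : 0 < commonCount w y := Finset.card_pos.2 ⟨x, by simpa using ⟨hw.2, hxy⟩⟩
    rw [commonCount_of_ne hw.1 hd] at hpos ⊢
    split_ifs at hpos ⊢ <;> simp_all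

theorem R_mul_twoStep_apply_of_not_le {x y : AttenuatedSpace h} (hxy : ¬ x ≤ y)
    (hd : dim y = dim x + 1) :
    (R h * twoStep h) x y = if Module.finrank F ↥(x.1 ⊔ y.1) = dim y + 1 then 1 else 0 := by
  classical
  have h1 := finrank_sup_add_dim_meet x y
  have h2 := dim_lt_finrank_sup hxy
  rw [R_mul_twoStep_apply]
  split_ifs with hs
  · rw [Nat.cast_eq_one, Finset.card_eq_one]
    refine ⟨meet x y, ?_⟩
    ext z
    simp only [Finset.mem_filter, Finset.mem_univ, true_and, Finset.mem_singleton, covBy_iff]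
    constructor
    · rintro ⟨hx, hy, -⟩
      exact eq_of_le_of_dim_le (le_meet hx.1 hy) (by omega)
    · rintro rfl
      exact ⟨⟨meet_le_left _ _, by omega⟩, meet_le_right _ _, by omega⟩
  · rw [Nat.cast_eq_zero, Finset.card_eq_zero, Finset.filter_eq_empty_iff]
    rintro z - ⟨hx, hy, -⟩
    rw [covBy_iff] at hx
    have h3 := dim_mono (le_meet hx.1 hy)
    omega

open Classical in
-- The sum `x + y` is the only candidate for the intermediate element, and it can fail to lie in the
-- poset. The same defect appears in `upCount_sup` and cancels in `twoStep_relation`.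
theorem twoStep_mul_R_apply_of_not_le {x y : AttenuatedSpace h} (hxy : ¬ x ≤ y)
    (hd : dim y = dim x + 1) :
    (twoStep h * R h) x y =
      if Module.finrank F ↥(x.1 ⊔ y.1) = dim y + 1 ∧ (x.1 ⊔ y.1) ⊓ h = ⊥ then 1 else 0 := by
  have h2 := dim_lt_finrank_sup hxy
  rw [twoStep_mul_R_apply]
  split_ifs with hs
  · obtain ⟨m, hm⟩ : ∃ m : AttenuatedSpace h, m.1 = x.1 ⊔ y.1 := ⟨⟨_, hs.2⟩, rfl⟩
    have hmd : dim m = dim y + 1 := by rw [dim, hm, hs.1]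
    have hxm : x ≤ m := le_def.2 (hm ▸ le_sup_left)
    have hym : y ≤ m := le_def.2 (hm ▸ le_sup_right)
    rw [Nat.cast_eq_one, Finset.card_eq_one]
    refine ⟨m, ?_⟩
    ext z
    simp only [Finset.mem_filter, Finset.mem_univ, true_and, Finset.mem_singleton, covBy_iff]
    constructor
    · rintro ⟨hy, hx, hz⟩
      exact (eq_of_le_of_dim_le (le_def.2 (hm ▸ sup_le (le_def.1 hx) (le_def.1 hy.1)))
        (by omega)).symm
    · rintro rfl
      exact ⟨⟨hym, hmd⟩, hxm, by omega⟩
  · rw [Nat.cast_eq_zero, Finset.card_eq_zero, Finset.filter_eq_empty_iff]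
    rintro z - ⟨hy, hx, hz⟩
    rw [covBy_iff] at hy
    have h3 := finrank_sup_le hx hy.1
    have hle : x.1 ⊔ y.1 ≤ z.1 := sup_le (le_def.1 hx) (le_def.1 hy.1)
    exact hs ⟨by omega, eq_bot_iff.2 ((inf_le_inf_right h hle).trans z.2.le)⟩

theorem L_mul_R_mul_L_apply_of_not_le {x y : AttenuatedSpace h} (hxy : ¬ x ≤ y)
    (hd : dim y = dim x + 1) :
    (L h * R h * L h) x y =
      if Module.finrank F ↥(x.1 ⊔ y.1) = dim y + 1 then (upCount x (x.1 ⊔ y.1) : ℂ) else 0 := by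
  classical
  have h2 := dim_lt_finrank_sup hxy
  rw [L_mul_R_mul_L_apply, Finset.sum_congr rfl
    (g := fun w => if Module.finrank F ↥(w.1 ⊔ y.1) = dim y + 1 then (1 : ℂ) else 0),
    Finset.sum_boole, Finset.filter_filter]
  · split_ifs with hs
    · unfold upCount
      congr 2
      ext w
      simp only [Finset.mem_filter, Finset.mem_univ, true_and]
      -- For `w` above `x`, the dimension condition says that `w + y` is no larger than `x + y`,
      -- that is, `w ≤ x + y`.
      refine and_congr_right fun hw => ⟨fun hf => ?_, fun hle => ?_⟩
      · have : x.1 ⊔ y.1 = w.1 ⊔ y.1 :=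
          Submodule.eq_of_le_of_finrank_eq (sup_le_sup_right (le_def.1 hw.le) _) (by rw [hs, hf])
        rw [this]
        exact le_sup_left
      · rw [← hs, le_antisymm (sup_le hle le_sup_right) (sup_le_sup_right (le_def.1 hw.le) y.1)]
    · rw [Nat.cast_eq_zero, Finset.card_eq_zero, Finset.filter_eq_empty_iff]
      rintro w - ⟨hw, hf⟩
      have : Module.finrank F ↥(x.1 ⊔ y.1) ≤ Module.finrank F ↥(w.1 ⊔ y.1) :=
        Submodule.finrank_mono (sup_le_sup_right (le_def.1 hw.le) _)
      omega
  · intro w hw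
    simp only [Finset.mem_filter, Finset.mem_univ, true_and] at hw
    rw [commonCount_of_ne]
    · simp
    · rintro rfl
      exact hxy hw.le
    · rw [(covBy_iff.1 hw).2, hd]

open Classical in
theorem upCount_sup {x y : AttenuatedSpace h} (hd : dim y = dim x + 1)
    (hs : Module.finrank F ↥(x.1 ⊔ y.1) = dim y + 1) :
    (upCount x (x.1 ⊔ y.1) : ℂ) = q F + if (x.1 ⊔ y.1) ⊓ h = ⊥ then 1 else 0 := by
  have h1 := upCount_mul x (le_sup_left (a := x.1) (b := y.1))
  have hq : q F ^ dim x * (q F - 1) ≠ 0 :=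
    mul_ne_zero (pow_ne_zero _ q_ne_zero) (sub_ne_zero.2 q_ne_one)
  apply mul_right_cancel₀ hq
  rw [h1, hs, hd]
  split_ifs with hb
  · rw [hb, finrank_bot]
    ring
  · have hpos : Module.finrank F ↥((x.1 ⊔ y.1) ⊓ h) ≠ 0 := by
      rwa [Ne, Submodule.finrank_eq_zero]
    -- Since `y` meets `h` trivially and has codimension one in `x + y`, the intersection of `x + y`
    -- with `h` has dimension at most one.
    have hle := Submodule.finrank_sup_add_finrank_inf_eq y.1 ((x.1 ⊔ y.1) ⊓ h)
    have hbot : y.1 ⊓ ((x.1 ⊔ y.1) ⊓ h) = ⊥ :=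
      eq_bot_iff.2 ((inf_le_inf_left _ inf_le_right).trans y.2.le)
    rw [hbot, finrank_bot] at hle
    have hle2 : Module.finrank F ↥(y.1 ⊔ (x.1 ⊔ y.1) ⊓ h) ≤ Module.finrank F ↥(x.1 ⊔ y.1) :=
      Submodule.finrank_mono (sup_le le_sup_right inf_le_left)
    have hy : Module.finrank F y.1 = dim y := rfl
    have : Module.finrank F ↥((x.1 ⊔ y.1) ⊓ h) = 1 := by omega
    rw [this]
    ring

/-! ### The defining relation and the centrality of `C₁` and `C₂` -/

section Relations

variable {N M : ℕ} (hH : Module.finrank F H = N + M) (hh : Module.finrank F h = M)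
include hH hh

/-- Three cases by entry. For a cover, the down-counts cancel by `downCount_eq` and the up-counts
leave a diagonal entry of `K`. For incomparable elements in consecutive dimensions, `q + ε = q + ε`,
with `ε` recording whether `x + y` misses `h`. In other dimensions every term is zero. -/
theorem twoStep_relation :
    q F • (R h * twoStep h) + twoStep h * R h - L h * R h * L h = -(L h * K h N M) := by
  classical
  ext x y
  rw [K_eq_diagonal (dim_le hH hh)]
  simp only [Matrix.sub_apply, Matrix.add_apply, Matrix.smul_apply, Matrix.neg_apply,
    Matrix.mul_diagonal, smul_eq_mul]
  by_cases hc : x ⋖ y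
  · rw [R_mul_twoStep_apply_of_covBy hc, twoStep_mul_R_apply_of_covBy hc,
      L_mul_R_mul_L_apply_of_covBy hc, downCount_eq hc,
      ← upCount_top_sub hH hh (covBy_iff.1 hc).2]
    simp only [L, Matrix.of_apply, if_pos hc]
    ring
  · have hL : L h x y = 0 := by simp [L, hc]
    rw [hL]
    by_cases hd : dim y = dim x + 1
    · have hxy : ¬ x ≤ y := fun hle => hc (covBy_iff.2 ⟨hle, hd⟩)
      rw [R_mul_twoStep_apply_of_not_le hxy hd, twoStep_mul_R_apply_of_not_le hxy hd,
        L_mul_R_mul_L_apply_of_not_le hxy hd]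
      by_cases hs : Module.finrank F ↥(x.1 ⊔ y.1) = dim y + 1
      · rw [if_pos hs, if_pos hs, upCount_sup hd hs]
        simp only [hs, true_and]
        ring
      · simp [hs]
    · have e1 : (R h * twoStep h) x y = 0 := by
        rw [R_mul_twoStep_apply, Nat.cast_eq_zero, Finset.card_eq_zero,
          Finset.filter_eq_empty_iff]
        rintro z - ⟨hz, -, hz2⟩
        rw [covBy_iff] at hz
        omega
      have e2 : (twoStep h * R h) x y = 0 := by
        rw [twoStep_mul_R_apply, Nat.cast_eq_zero, Finset.card_eq_zero,
          Finset.filter_eq_empty_iff]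
        rintro z - ⟨hz, -, hz2⟩
        rw [covBy_iff] at hz
        omega
      have e3 : (L h * R h * L h) x y = 0 := by
        rw [L_mul_R_mul_L_apply]
        refine Finset.sum_eq_zero fun w hw => ?_
        simp only [Finset.mem_filter, Finset.mem_univ, true_and] at hw
        rw [Nat.cast_eq_zero, commonCount, Finset.card_eq_zero, Finset.filter_eq_empty_iff]
        rintro z - ⟨hz, hz2⟩
        rw [covBy_iff] at hz hz2 hw
        omega
      rw [e1, e2, e3]
      ring

/-- The defining relation of the attenuated space as a uniform poset. -/
theorem L_relation : q F • (R h * (L h * L h)) - (q F + 1) • (L h * R h * L h) +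
    L h * L h * R h = -((q F + 1) • (L h * K h N M)) := by
  rw [L_mul_L, ← smul_neg, ← twoStep_relation hH hh]
  simp only [Matrix.mul_smul, Matrix.smul_mul, smul_add, smul_sub, smul_smul]
  rw [mul_comm (q F)]
  abel

theorem L_mul_K : L h * K h N M = -((q F + 1)⁻¹ • (q F • (R h * (L h * L h)) -
    (q F + 1) • (L h * R h * L h) + L h * L h * R h)) := by
  rw [L_relation hH hh, smul_neg, smul_smul, inv_mul_cancel₀ q_add_one_ne_zero, one_smul, neg_neg]

theorem K_mul_L : K h N M * L h = q F • (L h * K h N M) := by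
  ext x y
  rw [K_eq_diagonal (dim_le hH hh), Matrix.diagonal_mul, Matrix.smul_apply, Matrix.mul_diagonal,
    smul_eq_mul, L, Matrix.of_apply]
  split_ifs with hxy
  · rw [(covBy_iff.1 hxy).2, one_mul, mul_one, mul_comm, ← zpow_add_one₀ q_ne_zero]
    congr 1
    push_cast
    ring
  · simp

omit [Finite F] in
theorem transpose_K : (K h N M)ᵀ = K h N M := by
  rw [K_eq_diagonal (dim_le hH hh), Matrix.diagonal_transpose]

theorem R_mul_K : R h * K h N M = q F • (K h N M * R h) := by
  have := congrArg Matrix.transpose (K_mul_L hH hh)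
  rwa [Matrix.transpose_mul, Matrix.transpose_smul, Matrix.transpose_mul, transpose_K hH hh] at this

theorem commute_C₁_L : Commute (C₁ h N M) (L h) := by
  have h2 := K_mul_L hH hh
  have hq : q F ≠ 0 := q_ne_zero
  have hq1 : q F - 1 ≠ 0 := sub_ne_zero.2 q_ne_one
  have hq2 : q F + 1 ≠ 0 := q_add_one_ne_zero
  rw [commute_iff_eq, ← sub_eq_zero]
  unfold C₁
  simp only [add_mul, sub_mul, mul_add, mul_sub, Matrix.smul_mul, Matrix.mul_smul, h2, smul_smul,
    L_mul_K hH hh]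
  simp only [mul_assoc]
  match_scalars <;> field_simp <;> ring

theorem commute_C₂_L : Commute (C₂ h N M) (L h) := by
  have h2 := K_mul_L hH hh
  have h2' : ∀ A, K h N M * (L h * A) = q F • (L h * (K h N M * A)) := fun A => by
    rw [← mul_assoc, h2, Matrix.smul_mul, mul_assoc]
  have hq2 : q F + 1 ≠ 0 := q_add_one_ne_zero
  -- The relation multiplied on the right by `K`: once every `K` is moved to the right, `L K²` is
  -- the only term left to eliminate.
  have h4 : L h * (K h N M * K h N M) = -((q F + 1)⁻¹ • (q F • (R h * (L h * (L h * K h N M))) -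
    (q F + 1) • (L h * (R h * (L h * K h N M))) + L h * (L h * (R h * K h N M)))) := by
    have := congrArg (· * K h N M) (L_mul_K hH hh)
    simpa only [Matrix.neg_mul, Matrix.smul_mul, add_mul, sub_mul, mul_assoc] using this
  rw [commute_iff_eq, ← sub_eq_zero]
  unfold C₂
  simp only [pow_two, add_mul, sub_mul, mul_add, mul_sub, Matrix.smul_mul, Matrix.mul_smul, h2,
    h2', smul_smul, mul_assoc]
  rw [h4]
  match_scalars <;> field_simp <;> ring

theorem transpose_C₁ : (C₁ h N M)ᵀ = C₁ h N M := by
  simp [C₁, Matrix.transpose_mul, transpose_K hH hh, transpose_L, transpose_R]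

theorem commute_K_RL : Commute (K h N M) (R h * L h) := by
  have h1 := R_mul_K hH hh
  have h2 := K_mul_L hH hh
  unfold Commute SemiconjBy
  apply smul_right_injective _ (q_ne_zero (F := F))
  simp only
  rw [← mul_assoc, ← Matrix.smul_mul, ← h1, mul_assoc, h2, Matrix.mul_smul, mul_assoc]

theorem commute_K_LR : Commute (K h N M) (L h * R h) := by
  have h1 := R_mul_K hH hh
  have h2 := K_mul_L hH hh
  unfold Commute SemiconjBy
  rw [← mul_assoc, h2, Matrix.smul_mul, mul_assoc, mul_assoc, h1, Matrix.mul_smul]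

/-- Transposition puts `K` on the other side of `R L` and `L R`, with both of which it commutes. -/
theorem transpose_C₂ : (C₂ h N M)ᵀ = C₂ h N M := by
  simp only [C₂, Matrix.transpose_add, Matrix.transpose_sub, Matrix.transpose_smul,
    Matrix.transpose_mul, Matrix.transpose_pow, transpose_K hH hh, transpose_L, transpose_R,
    (commute_K_RL hH hh).eq, (commute_K_LR hH hh).eq]

theorem commute_C₁_R : Commute (C₁ h N M) (R h) := by
  have := congrArg Matrix.transpose (commute_C₁_L hH hh).eq
  rw [Matrix.transpose_mul, Matrix.transpose_mul, transpose_C₁ hH hh, transpose_L] at this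
  exact this.symm

theorem commute_C₂_R : Commute (C₂ h N M) (R h) := by
  have := congrArg Matrix.transpose (commute_C₂_L hH hh).eq
  rw [Matrix.transpose_mul, Matrix.transpose_mul, transpose_C₂ hH hh, transpose_L] at this
  exact this.symm

theorem commute_C₁_K : Commute (C₁ h N M) (K h N M) :=
  ((((Commute.refl _).smul_right _).add_right (commute_K_RL hH hh)).sub_right
    ((commute_K_LR hH hh).smul_right _)).symm

theorem commute_C₂_K : Commute (C₂ h N M) (K h N M) :=
  ((((Commute.refl _).pow_right _).add_right
    (((commute_K_RL hH hh).mul_right (Commute.refl _)).smul_right _)).sub_right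
    (((commute_K_LR hH hh).mul_right (Commute.refl _)).smul_right _)).symm

end Relations

end

section

variable {F H : Type*} [Field F] [AddCommGroup H] [Module F H] {h : Submodule F H}
variable [FiniteDimensional F H] [Finite F]

/-! ### Membership in `T` and in its center -/

section Generators

variable (h) (N M : ℕ)

theorem R_mem_T : R h ∈ T h N M := Algebra.subset_adjoin (by simp)

theorem L_mem_T : L h ∈ T h N M := Algebra.subset_adjoin (by simp)

theorem K_mem_T : K h N M ∈ T h N M := Algebra.subset_adjoin (by simp)

theorem K_inv_mem_T : (K h N M)⁻¹ ∈ T h N M := Algebra.subset_adjoin (by simp)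

theorem C₁_mem_T : C₁ h N M ∈ T h N M :=
  sub_mem (add_mem (Subalgebra.smul_mem _ (K_mem_T h N M) _)
    (mul_mem (R_mem_T h N M) (L_mem_T h N M)))
    (Subalgebra.smul_mem _ (mul_mem (L_mem_T h N M) (R_mem_T h N M)) _)

theorem C₂_mem_T : C₂ h N M ∈ T h N M :=
  sub_mem (add_mem (pow_mem (K_mem_T h N M) 2) (Subalgebra.smul_mem _ (mul_mem
    (mul_mem (R_mem_T h N M) (L_mem_T h N M)) (K_mem_T h N M)) _))
    (Subalgebra.smul_mem _ (mul_mem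
      (mul_mem (L_mem_T h N M) (R_mem_T h N M)) (K_mem_T h N M)) _)

variable {h N M}

theorem mulVec_mem (W : Submodule (T h N M) (AttenuatedSpace h → ℂ))
    {A : Matrix (AttenuatedSpace h) (AttenuatedSpace h) ℂ} (hA : A ∈ T h N M)
    {w : AttenuatedSpace h → ℂ} (hw : w ∈ W) : A *ᵥ w ∈ W :=
  W.smul_mem (⟨A, hA⟩ : T h N M) hw

theorem mem_centerT {A : Matrix (AttenuatedSpace h) (AttenuatedSpace h) ℂ} :
    A ∈ centerT h N M ↔ A ∈ T h N M ∧ ∀ B ∈ T h N M, Commute B A := by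
  simp only [centerT, Subalgebra.mem_map, Subalgebra.mem_center_iff]
  constructor
  · rintro ⟨A, hA, rfl⟩
    exact ⟨A.2, fun B hB => congrArg Subtype.val (hA ⟨B, hB⟩)⟩
  · rintro ⟨hA, hc⟩
    exact ⟨⟨A, hA⟩, fun B => Subtype.ext (hc B.1 B.2), rfl⟩

theorem commute_K_inv {A : Matrix (AttenuatedSpace h) (AttenuatedSpace h) ℂ}
    (hA : Commute A (K h N M)) : Commute A (K h N M)⁻¹ :=
  Matrix.inv_def (K h N M) ▸ by
    by_cases hu : IsUnit (K h N M)
    · rw [← Matrix.inv_def]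
      obtain ⟨u, hu⟩ := hu
      rw [← hu, ← Matrix.coe_units_inv]
      exact (hu ▸ hA : Commute A (u : Matrix _ _ ℂ)).units_inv_right
    -- The dimensions are not assumed here, so `K` might be singular; its inverse is then `0` by
    -- convention.
    · rw [← Matrix.inv_def, Matrix.nonsing_inv_apply_not_isUnit _
        (mt (Matrix.isUnit_iff_isUnit_det _).2 hu)]
      exact Commute.zero_right A

theorem mem_centerT_of_commute {A : Matrix (AttenuatedSpace h) (AttenuatedSpace h) ℂ}
    (hA : A ∈ T h N M) (hR : Commute A (R h)) (hL : Commute A (L h))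
    (hK : Commute A (K h N M)) : A ∈ centerT h N M := by
  refine mem_centerT.2 ⟨hA, ?_⟩
  have hle : T h N M ≤ Subalgebra.centralizer ℂ {A} := by
    refine Algebra.adjoin_le ?_
    rintro B hB
    simp only [Set.mem_insert_iff, Set.mem_singleton_iff] at hB
    rw [SetLike.mem_coe, Subalgebra.mem_centralizer_iff]
    rintro _ rfl
    rcases hB with rfl | rfl | rfl | rfl
    exacts [hR, hL, hK, commute_K_inv hK]
  intro B hB
  exact ((Subalgebra.mem_centralizer_iff ℂ).1 (hle hB) A rfl).symm

/-- A complex subspace of a `T`-module is stable under `T` once it is stable under the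
generators. -/
theorem smul_mem_span_range {E ι : Type*} [AddCommGroup E] [Module ℂ E] [Module (T h N M) E]
    [IsScalarTower ℂ (T h N M) E] [SMulCommClass (T h N M) ℂ E] {u : ι → E}
    (hR : ∀ k, (⟨R h, R_mem_T h N M⟩ : T h N M) • u k ∈ Submodule.span ℂ (Set.range u))
    (hL : ∀ k, (⟨L h, L_mem_T h N M⟩ : T h N M) • u k ∈ Submodule.span ℂ (Set.range u))
    (hK : ∀ k, (⟨K h N M, K_mem_T h N M⟩ : T h N M) • u k ∈ Submodule.span ℂ (Set.range u))
    (hK' : ∀ k, (⟨(K h N M)⁻¹, K_inv_mem_T h N M⟩ : T h N M) • u k ∈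
      Submodule.span ℂ (Set.range u))
    (t : T h N M) {e : E} (he : e ∈ Submodule.span ℂ (Set.range u)) :
    t • e ∈ Submodule.span ℂ (Set.range u) := by
  have hgen : ∀ t : T h N M, (∀ k, t • u k ∈ Submodule.span ℂ (Set.range u)) →
      ∀ e ∈ Submodule.span ℂ (Set.range u), t • e ∈ Submodule.span ℂ (Set.range u) := by
    intro t ht e he
    induction he using Submodule.span_induction with
    | mem x hx => obtain ⟨k, rfl⟩ := hx; exact ht k
    | zero => rw [smul_zero]; exact zero_mem _
    | add x y _ _ hx hy => rw [smul_add]; exact add_mem hx hy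
    | smul c x _ hx => rw [smul_comm]; exact Submodule.smul_mem _ c hx
  obtain ⟨A, hA⟩ := t
  have key : ∀ e ∈ Submodule.span ℂ (Set.range u),
      (⟨A, hA⟩ : T h N M) • e ∈ Submodule.span ℂ (Set.range u) := by
    refine Algebra.adjoin_induction (p := fun A hA => ∀ e ∈ Submodule.span ℂ (Set.range u),
      (⟨A, hA⟩ : T h N M) • e ∈ Submodule.span ℂ (Set.range u)) ?_ ?_ ?_ ?_ hA
    · intro A hA
      simp only [Set.mem_insert_iff, Set.mem_singleton_iff] at hA
      rcases hA with rfl | rfl | rfl | rfl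
      exacts [hgen _ hR, hgen _ hL, hgen _ hK, hgen _ hK']
    · intro c e he
      have : (algebraMap ℂ (T h N M) c) • e ∈ Submodule.span ℂ (Set.range u) := by
        rw [algebraMap_smul]
        exact Submodule.smul_mem _ c he
      exact this
    · intro A B hA hB h1 h2 e he
      have := add_mem (h1 e he) (h2 e he)
      rwa [← add_smul] at this
    · intro A B hA hB h1 h2 e he
      have := h1 _ (h2 e he)
      rwa [smul_smul] at this
  exact key e he

end Generators

/-! ### The grading by dimension -/

section Grading

/-- The column vectors supported on the elements of dimension `i`. -/
def homog (h : Submodule F H) (i : ℕ) : Submodule ℂ (AttenuatedSpace h → ℂ) where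
  carrier := {v | ∀ x, dim x ≠ i → v x = 0}
  add_mem' hv hw x hx := by simp [hv x hx, hw x hx]
  zero_mem' _ _ := rfl
  smul_mem' c v hv x hx := by simp [hv x hx]

theorem R_mulVec_mem_homog {i : ℕ} {v : AttenuatedSpace h → ℂ} (hv : v ∈ homog h i) :
    R h *ᵥ v ∈ homog h (i + 1) := by
  intro x hx
  refine Finset.sum_eq_zero fun y _ => ?_
  by_cases hxy : y ⋖ x
  · rw [hv y, mul_zero]
    have := (covBy_iff.1 hxy).2
    omega
  · simp [R, hxy]

theorem L_mulVec_mem_homog {i : ℕ} {v : AttenuatedSpace h → ℂ} (hv : v ∈ homog h (i + 1)) :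
    L h *ᵥ v ∈ homog h i := by
  intro x hx
  refine Finset.sum_eq_zero fun y _ => ?_
  by_cases hxy : x ⋖ y
  · rw [hv y, mul_zero]
    have := (covBy_iff.1 hxy).2
    omega
  · simp [L, hxy]

theorem L_mulVec_of_homog_zero {v : AttenuatedSpace h → ℂ} (hv : v ∈ homog h 0) :
    L h *ᵥ v = 0 := by
  ext x
  refine Finset.sum_eq_zero fun y _ => ?_
  by_cases hxy : x ⋖ y
  · rw [hv y, mul_zero]
    have := (covBy_iff.1 hxy).2
    omega
  · simp [L, hxy]

theorem proj_mulVec_apply (i : ℕ) (v : AttenuatedSpace h → ℂ) (x : AttenuatedSpace h) :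
    (proj h i *ᵥ v) x = if dim x = i then v x else 0 := by
  rw [proj, Matrix.mulVec_diagonal, ite_mul, one_mul, zero_mul]

theorem proj_mulVec_mem_homog (i : ℕ) (v : AttenuatedSpace h → ℂ) :
    proj h i *ᵥ v ∈ homog h i := fun x hx => by
  rw [proj_mulVec_apply, if_neg hx]

theorem proj_mulVec_of_mem {i : ℕ} {v : AttenuatedSpace h → ℂ} (hv : v ∈ homog h i) :
    proj h i *ᵥ v = v := by
  ext x
  rw [proj_mulVec_apply]
  split_ifs with hx
  · rfl
  · exact (hv x hx).symm

theorem proj_mulVec_of_ne {i j : ℕ} (hij : j ≠ i) {v : AttenuatedSpace h → ℂ}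
    (hv : v ∈ homog h j) : proj h i *ᵥ v = 0 := by
  ext x
  rw [proj_mulVec_apply]
  split_ifs with hx
  · exact hv x (by omega)
  · rfl

theorem eq_zero_of_proj_mulVec {v : AttenuatedSpace h → ℂ} (hv : ∀ i, proj h i *ᵥ v = 0) :
    v = 0 := by
  ext x
  have := congrFun (hv (dim x)) x
  rwa [proj_mulVec_apply, if_pos rfl] at this

variable {N M : ℕ} (hH : Module.finrank F H = N + M) (hh : Module.finrank F h = M)
include hH hh

omit [Finite F] in
theorem le_of_mem_homog {i : ℕ} {v : AttenuatedSpace h → ℂ} (hv : v ∈ homog h i)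
    (hv0 : v ≠ 0) : i ≤ N := by
  by_contra hi
  apply hv0
  ext x
  refine hv x ?_
  have := dim_le hH hh x
  omega

theorem K_mulVec_of_mem {i : ℕ} {v : AttenuatedSpace h → ℂ} (hv : v ∈ homog h i) :
    K h N M *ᵥ v = q F ^ ((N : ℤ) + M - i) • v := by
  ext x
  rw [K_eq_diagonal (dim_le hH hh), Matrix.mulVec_diagonal, Pi.smul_apply, smul_eq_mul]
  by_cases hx : dim x = i
  · rw [hx]
  · rw [hv x hx, mul_zero, mul_zero]

theorem K_inv_mul_K : (K h N M)⁻¹ * K h N M = 1 := by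
  refine Matrix.nonsing_inv_mul _ ?_
  rw [K_eq_diagonal (dim_le hH hh), Matrix.det_diagonal, isUnit_iff_ne_zero,
    Finset.prod_ne_zero_iff]
  exact fun x _ => zpow_ne_zero _ q_ne_zero

/-- The diagonal entries of `K` differ on different levels, so a Lagrange polynomial evaluated at
`K` isolates level `i`. -/
theorem proj_mem_T (i : ℕ) : proj h i ∈ T h N M := by
  classical
  set d : AttenuatedSpace h → ℂ := fun x => q F ^ ((N : ℤ) + M - dim x) with hd
  have hinj : ∀ x : AttenuatedSpace h, d x = q F ^ ((N : ℤ) + M - i) ↔ dim x = i := by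
    intro x
    constructor
    · intro hx
      have := q_zpow_injective hx
      omega
    · rintro rfl
      rfl
  let f : ℂ → ℂ := fun z => if z = q F ^ ((N : ℤ) + M - i) then 1 else 0
  let p := Lagrange.interpolate (Finset.univ.image d) id f
  have hp : Polynomial.aeval (K h N M) p = proj h i := by
    have h1 : K h N M = Matrix.diagonalAlgHom ℂ d := K_eq_diagonal (dim_le hH hh)
    rw [h1, Polynomial.aeval_algHom_apply, Matrix.diagonalAlgHom_apply, proj]
    congr 1
    ext x
    have h2 : Polynomial.aeval d p x = p.eval (d x) := by
      have := Polynomial.aeval_algHom_apply (Pi.evalAlgHom ℂ (fun _ => ℂ) x) d p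
      rw [Pi.evalAlgHom_apply, Pi.evalAlgHom_apply] at this
      rw [← this, Polynomial.coe_aeval_eq_eval]
    have h3 := Lagrange.eval_interpolate_at_node (s := Finset.univ.image d) (v := id) f
      Function.injective_id.injOn (Finset.mem_image_of_mem d (Finset.mem_univ x))
    rw [h2]
    refine h3.trans ?_
    simp only [f, hinj]
  rw [← hp]
  exact Algebra.adjoin_mono (by simp) (Polynomial.aeval_mem_adjoin_singleton ℂ (K h N M))

end Grading

end

/-! ### Separation of types, and strings generated by raising -/

section

variable {F H : Type*} [Field F] [AddCommGroup H] [Module F H] {h : Submodule F H}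
variable [FiniteDimensional F H] [Finite F]

/-- The scalars give the sum and the product of `q^{N+M-r}` and `q^{N+M-r-d-1}`, hence this
unordered pair. Swapping the two roots is excluded because `d` and `d'` are nonnegative. -/
theorem scalars_injective {N M : ℕ} {t t' : ℕ × ℕ} (h1 : scalar₁ F N M t = scalar₁ F N M t')
    (h2 : scalar₂ F N M t = scalar₂ F N M t') : t = t' := by
  have hq : q F ≠ 0 := q_ne_zero
  have hq1 : q F - 1 ≠ 0 := sub_ne_zero.2 q_ne_one
  obtain ⟨r, d⟩ := t
  obtain ⟨r', d'⟩ := t'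
  simp only [scalar₁, mul_assoc, mul_right_inj' (inv_ne_zero hq1)] at h1
  simp only [mul_add, mul_one, ← zpow_add₀ hq] at h1
  have e2 := q_zpow_injective h2
  have hprod : q F ^ ((N : ℤ) + M - r) * q F ^ ((N : ℤ) + M - r + (-d - 1)) =
      q F ^ ((N : ℤ) + M - r') * q F ^ ((N : ℤ) + M - r' + (-d' - 1)) := by
    rw [← zpow_add₀ hq, ← zpow_add₀ hq]
    congr 1
    omega
  -- Vieta: one root of the first quadratic is a root of the second.
  have hz : (q F ^ ((N : ℤ) + M - r) - q F ^ ((N : ℤ) + M - r')) *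
      (q F ^ ((N : ℤ) + M - r) - q F ^ ((N : ℤ) + M - r' + (-d' - 1))) = 0 := by
    linear_combination (q F ^ ((N : ℤ) + M - r)) * h1 - hprod
  rcases mul_eq_zero.1 hz with hz | hz
  · have := q_zpow_injective (sub_eq_zero.1 hz)
    ext <;> simp only <;> omega
  · have := q_zpow_injective (sub_eq_zero.1 hz)
    omega

theorem C₁_mulVec (N M : ℕ) (v : AttenuatedSpace h → ℂ) : C₁ h N M *ᵥ v =
    ((q F)⁻¹ * (q F - 1)⁻¹ * (q F + 1)) • (K h N M *ᵥ v) + R h *ᵥ (L h *ᵥ v) -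
      (q F)⁻¹ • (L h *ᵥ (R h *ᵥ v)) := by
  simp only [C₁, Matrix.sub_mulVec, Matrix.add_mulVec, Matrix.smul_mulVec, Matrix.mulVec_mulVec]

theorem C₂_mulVec (N M : ℕ) (v : AttenuatedSpace h → ℂ) : C₂ h N M *ᵥ v =
    K h N M *ᵥ (K h N M *ᵥ v) + (q F - 1) • (R h *ᵥ (L h *ᵥ (K h N M *ᵥ v))) -
      (q F - 1) • (L h *ᵥ (R h *ᵥ (K h N M *ᵥ v))) := by
  simp only [C₂, Matrix.sub_mulVec, Matrix.add_mulVec, Matrix.smul_mulVec, Matrix.mulVec_mulVec,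
    pow_two, mul_assoc]

/-- The coefficient of `L` on the `k`-th step of a string on which `C₁` acts as `c` and whose
lowest vector has `K`-eigenvalue `κ`. -/
def ladderCoeff (p κ c : ℂ) (k : ℕ) : ℂ :=
  c * p / (p - 1) * (1 - p ^ k) + p / (p - 1) ^ 2 * κ * (p ^ k - (p ^ k)⁻¹)

theorem ladderCoeff_zero (p κ c : ℂ) : ladderCoeff p κ c 0 = 0 := by
  simp [ladderCoeff]

theorem ladderCoeff_succ {p : ℂ} (hp : p ≠ 0) (hp1 : p - 1 ≠ 0) (κ c : ℂ) (k : ℕ) :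
    ladderCoeff p κ c (k + 1) =
      p * (p⁻¹ * (p - 1)⁻¹ * (p + 1) * (κ * (p ^ k)⁻¹) + ladderCoeff p κ c k - c) := by
  unfold ladderCoeff
  have : p ^ k ≠ 0 := pow_ne_zero _ hp
  field_simp
  ring

/-- The vectors obtained from `v` by repeated raising. -/
def raise (v : AttenuatedSpace h → ℂ) (k : ℕ) : AttenuatedSpace h → ℂ := R h ^ k *ᵥ v

theorem raise_zero (v : AttenuatedSpace h → ℂ) : raise v 0 = v := by
  rw [raise, pow_zero, Matrix.one_mulVec]

theorem R_mulVec_raise (v : AttenuatedSpace h → ℂ) (k : ℕ) :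
    R h *ᵥ raise v k = raise v (k + 1) := by
  rw [raise, raise, Matrix.mulVec_mulVec, pow_succ']

theorem raise_mem_homog {r : ℕ} {v : AttenuatedSpace h → ℂ} (hv : v ∈ homog h r) (k : ℕ) :
    raise v k ∈ homog h (r + k) := by
  induction k with
  | zero => rwa [raise_zero]
  | succ k ih => rw [← R_mulVec_raise]; exact R_mulVec_mem_homog ih

theorem raise_eq_zero_of_le {v : AttenuatedSpace h → ℂ} {j k : ℕ} (hjk : j ≤ k)
    (hj : raise v j = 0) : raise v k = 0 := by
  induction k, hjk using Nat.le_induction with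
  | base => exact hj
  | succ k _ ih => rw [← R_mulVec_raise, ih, Matrix.mulVec_zero]

variable {N M : ℕ}

theorem raise_mem (W : Submodule (T h N M) (AttenuatedSpace h → ℂ)) {v : AttenuatedSpace h → ℂ}
    (hv : v ∈ W) (k : ℕ) : raise v k ∈ W :=
  mulVec_mem W (pow_mem (R_mem_T h N M) k) hv

/-- A central element acts as a scalar on a simple module. -/
theorem exists_scalar {A : Matrix (AttenuatedSpace h) (AttenuatedSpace h) ℂ}
    (hA : A ∈ centerT h N M) (W : Submodule (T h N M) (AttenuatedSpace h → ℂ))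
    (hW : IsSimpleModule (T h N M) W) : ∃ c : ℂ, ∀ w ∈ W, A *ᵥ w = c • w := by
  obtain ⟨hAT, hAc⟩ := mem_centerT.1 hA
  let f : Module.End (T h N M) W :=
    { toFun := fun w => ⟨A *ᵥ w.1, mulVec_mem W hAT w.2⟩
      map_add' := fun x y => Subtype.ext (Matrix.mulVec_add A x.1 y.1)
      map_smul' := fun t w => by
        refine Subtype.ext ?_
        change A *ᵥ (t.1 *ᵥ w.1) = t.1 *ᵥ (A *ᵥ w.1)
        rw [Matrix.mulVec_mulVec, Matrix.mulVec_mulVec, (hAc t.1 t.2).eq] }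
  have : FiniteDimensional ℂ W :=
    inferInstanceAs (FiniteDimensional ℂ (W.restrictScalars ℂ))
  obtain ⟨c, hc⟩ := (IsSimpleModule.algebraMap_end_bijective_of_isAlgClosed
    (A := T h N M) (V := W) ℂ).2 f
  exact ⟨c, fun w hw => (congrArg Subtype.val (LinearMap.congr_fun hc ⟨w, hw⟩)).symm⟩

section

variable (hH : Module.finrank F H = N + M) (hh : Module.finrank F h = M)
include hH hh

theorem C₁_mem_centerT : C₁ h N M ∈ centerT h N M :=
  mem_centerT_of_commute (C₁_mem_T h N M) (commute_C₁_R hH hh) (commute_C₁_L hH hh)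
    (commute_C₁_K hH hh)

theorem C₂_mem_centerT : C₂ h N M ∈ centerT h N M :=
  mem_centerT_of_commute (C₂_mem_T h N M) (commute_C₂_R hH hh) (commute_C₂_L hH hh)
    (commute_C₂_K hH hh)

/-- The projections lie in `T`, so `W` contains nonzero homogeneous vectors; one of least degree is
killed by `L`. -/
theorem exists_lowest (W : Submodule (T h N M) (AttenuatedSpace h → ℂ)) (hW : W ≠ ⊥) :
    ∃ r, ∃ v ∈ W, v ∈ homog h r ∧ v ≠ 0 ∧ L h *ᵥ v = 0 := by
  classical
  obtain ⟨w, hw, hw0⟩ := W.ne_bot_iff.1 hW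
  have hex : ∃ i, ∃ v ∈ W, v ∈ homog h i ∧ v ≠ 0 := by
    by_contra hcon
    push Not at hcon
    exact hw0 (eq_zero_of_proj_mulVec fun i => hcon i _ (mulVec_mem W (proj_mem_T hH hh i) hw)
      (proj_mulVec_mem_homog i w))
  obtain ⟨v, hvW, hv, hv0⟩ := Nat.find_spec hex
  refine ⟨Nat.find hex, v, hvW, hv, hv0, ?_⟩
  by_contra hLv
  rcases hr : Nat.find hex with _ | r
  · exact hLv (L_mulVec_of_homog_zero (hr ▸ hv))
  · exact Nat.find_min hex (m := r) (by omega)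
      ⟨_, mulVec_mem W (L_mem_T h N M) hvW, L_mulVec_mem_homog (hr ▸ hv), hLv⟩

/-- The eigenvalue equation for `C₁` expresses `L R` through `R L` and `K`, which by induction act
as scalars on `R^k v`. The resulting recursion is `ladderCoeff_succ`. -/
theorem L_mulVec_raise {r : ℕ} {v : AttenuatedSpace h → ℂ} (hv : v ∈ homog h r)
    (hL : L h *ᵥ v = 0) {c : ℂ} (hc : ∀ k, C₁ h N M *ᵥ raise v k = c • raise v k) (k : ℕ) :
    L h *ᵥ raise v (k + 1) =
      ladderCoeff (q F) (q F ^ ((N : ℤ) + M - r)) c (k + 1) • raise v k := by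
  have hq : q F ≠ 0 := q_ne_zero
  have hq1 : q F - 1 ≠ 0 := sub_ne_zero.2 q_ne_one
  have hstep : ∀ k, R h *ᵥ (L h *ᵥ raise v k) =
      ladderCoeff (q F) (q F ^ ((N : ℤ) + M - r)) c k • raise v k → L h *ᵥ raise v (k + 1) =
      ladderCoeff (q F) (q F ^ ((N : ℤ) + M - r)) c (k + 1) • raise v k := by
    intro k hk
    have h1 := hc k
    rw [C₁_mulVec, hk, K_mulVec_of_mem hH hh (raise_mem_homog hv k), R_mulVec_raise] at h1
    have h2 : L h *ᵥ raise v (k + 1) = q F • ((q F)⁻¹ • (L h *ᵥ raise v (k + 1))) := by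
      rw [smul_smul, mul_inv_cancel₀ hq, one_smul]
    rw [h2, ← sub_eq_iff_eq_add'.2 (sub_eq_iff_eq_add.1 h1), ladderCoeff_succ hq hq1,
      Nat.cast_add, ← sub_sub, zpow_sub₀ hq _ (k : ℤ), zpow_natCast]
    module
  refine hstep k ?_
  induction k with
  | zero => rw [raise_zero, hL, Matrix.mulVec_zero, ladderCoeff_zero, zero_smul]
  | succ k ih => rw [hstep k ih, Matrix.mulVec_smul, R_mulVec_raise]

end

end

/-! ### Structure and classification of simple modules -/

section

variable {F H : Type*} [Field F] [AddCommGroup H] [Module F H] {h : Submodule F H}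
variable [FiniteDimensional F H] [Finite F]

section Modules

variable {A V : Type*} [Ring A] [AddCommGroup V] [Module A V] {W W' : Submodule A V}

/-- Both modules are quotients of `A` by the common annihilator of the chosen generators. -/
theorem nonempty_linearEquiv_of_smul_eq_zero_iff (hW : IsSimpleModule A W)
    (hW' : IsSimpleModule A W') {v v' : V} (hv : v ∈ W) (hv' : v' ∈ W') (hv0 : v ≠ 0)
    (hv0' : v' ≠ 0) (hvv' : ∀ t : A, t • v = 0 ↔ t • v' = 0) : Nonempty (W ≃ₗ[A] W') := by
  have hker : LinearMap.ker (LinearMap.toSpanSingleton A W ⟨v, hv⟩) =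
      LinearMap.ker (LinearMap.toSpanSingleton A W' ⟨v', hv'⟩) := by
    ext t
    rw [LinearMap.mem_ker, LinearMap.mem_ker, LinearMap.toSpanSingleton_apply,
      LinearMap.toSpanSingleton_apply, Subtype.ext_iff, Subtype.ext_iff]
    exact hvv' t
  have hs := IsSimpleModule.toSpanSingleton_surjective A (m := (⟨v, hv⟩ : W))
    fun h0 => hv0 (congrArg Subtype.val h0)
  have hs' := IsSimpleModule.toSpanSingleton_surjective A (m := (⟨v', hv'⟩ : W'))
    fun h0 => hv0' (congrArg Subtype.val h0)
  exact ⟨(LinearMap.quotKerEquivOfSurjective _ hs).symm.trans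
    ((Submodule.quotEquivOfEq _ _ hker).trans (LinearMap.quotKerEquivOfSurjective _ hs'))⟩

theorem smul_linearEquiv_ne_zero (f : W ≃ₗ[A] W') (t : A) (w : W) (hw : t • (w : V) ≠ 0) :
    t • (f w : V) ≠ 0 := by
  intro h0
  have h1 : f (t • w) = 0 := by
    rw [f.map_smul]
    exact Subtype.ext h0
  exact hw (congrArg Subtype.val (f.map_eq_zero_iff.1 h1))

end Modules

/-- With `x = p^(d+1)`, one has `x - x⁻¹ = -(1 - x)(1 + x⁻¹)`, so the coefficient has the nonzero
factor `1 - x`; what remains is linear in `c`. -/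
theorem eq_of_ladderCoeff_eq_zero {p : ℂ} (hp : p ≠ 0) (hp1 : p - 1 ≠ 0) {κ c : ℂ} {d : ℕ}
    (hd : p ^ (d + 1) ≠ 1) (h0 : ladderCoeff p κ c (d + 1) = 0) :
    c = (p - 1)⁻¹ * κ * (1 + (p ^ (d + 1))⁻¹) := by
  unfold ladderCoeff at h0
  have hx : p ^ (d + 1) ≠ 0 := pow_ne_zero _ hp
  generalize p ^ (d + 1) = x at *
  have h1 : 1 - x ≠ 0 := sub_ne_zero.2 hd.symm
  field_simp at h0 ⊢
  apply mul_right_cancel₀ h1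
  linear_combination (mul_eq_zero.1 (h0.trans (mul_zero _))).resolve_left hp

theorem q_pow_succ_ne_one (d : ℕ) : q F ^ (d + 1) ≠ 1 := by
  intro h1
  have := q_zpow_injective (F := F) (a₁ := ((d + 1 : ℕ) : ℤ)) (a₂ := 0)
    (by simpa only [zpow_natCast, zpow_zero] using h1)
  omega

omit [Field F] [Finite F] in
theorem scalar₁_eq (N M r d : ℕ) : scalar₁ F N M (r, d) =
    (q F - 1)⁻¹ * q F ^ ((N : ℤ) + M - r) * (1 + (q F ^ (d + 1))⁻¹) := by
  rw [scalar₁, ← zpow_natCast, ← zpow_neg]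
  congr 4
  push_cast
  ring

variable {N M : ℕ} (hH : Module.finrank F H = N + M) (hh : Module.finrank F h = M)
include hH hh

/-- The module `E` is left general because the lemma is applied both to the standard module and to
the product of two copies of it. -/
theorem smul_mem_span_of_string {E : Type*} [AddCommGroup E] [Module ℂ E] [Module (T h N M) E]
    [IsScalarTower ℂ (T h N M) E] [SMulCommClass (T h N M) ℂ E] {u : ℕ → E} {κ a : ℕ → ℂ}
    (hR : ∀ k, (⟨R h, R_mem_T h N M⟩ : T h N M) • u k = u (k + 1))
    (hL0 : (⟨L h, L_mem_T h N M⟩ : T h N M) • u 0 = 0)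
    (hL : ∀ k, (⟨L h, L_mem_T h N M⟩ : T h N M) • u (k + 1) = a k • u k)
    (hκ : ∀ k, κ k ≠ 0)
    (hK : ∀ k, (⟨K h N M, K_mem_T h N M⟩ : T h N M) • u k = κ k • u k)
    (t : T h N M) {e : E} (he : e ∈ Submodule.span ℂ (Set.range u)) :
    t • e ∈ Submodule.span ℂ (Set.range u) := by
  have hu : ∀ k, u k ∈ Submodule.span ℂ (Set.range u) :=
    fun k => Submodule.subset_span ⟨k, rfl⟩
  refine smul_mem_span_range (fun k => ?_) (fun k => ?_) (fun k => ?_) (fun k => ?_) t he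
  · rw [hR]
    exact hu _
  · cases k with
    | zero => rw [hL0]; exact zero_mem _
    | succ k => rw [hL]; exact Submodule.smul_mem _ _ (hu k)
  · rw [hK]
    exact Submodule.smul_mem _ _ (hu k)
  · have h1 : (⟨(K h N M)⁻¹, K_inv_mem_T h N M⟩ : T h N M) • u k = (κ k)⁻¹ • u k := by
      rw [eq_inv_smul_iff₀ (hκ k), ← smul_comm, ← hK, smul_smul]
      have : (⟨(K h N M)⁻¹, K_inv_mem_T h N M⟩ : T h N M) * ⟨K h N M, K_mem_T h N M⟩ = 1 :=
        Subtype.ext (K_inv_mul_K hH hh)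
      rw [this, one_smul]
    rw [h1]
    exact Submodule.smul_mem _ _ (hu k)

/-- A simple module of type `(r, d)` has a basis `v, Rv, …, R^d v` with `v` of degree `r` and
`Lv = 0`, and `C₁` and `C₂` act on it as the scalars attached to its type. -/
theorem exists_string (W : Submodule (T h N M) (AttenuatedSpace h → ℂ))
    (hW : IsSimpleModule (T h N M) W) :
    ∃ v ∈ W, v ∈ homog h (endpoint W) ∧ L h *ᵥ v = 0 ∧
      (∀ k, raise v k = 0 ↔ diameter W < k) ∧
      support W = Set.Ico (endpoint W) (endpoint W + (diameter W + 1)) ∧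
      (∀ w ∈ W, C₁ h N M *ᵥ w = scalar₁ F N M (type W) • w) ∧
      (∀ w ∈ W, C₂ h N M *ᵥ w = scalar₂ F N M (type W) • w) := by
  classical
  have hq : q F ≠ 0 := q_ne_zero
  have hq1 : q F - 1 ≠ 0 := sub_ne_zero.2 q_ne_one
  have hatom := isSimpleModule_iff_isAtom.1 hW
  obtain ⟨r, v, hvW, hv, hv0, hLv⟩ := exists_lowest hH hh W hatom.1
  obtain ⟨c, hc⟩ := exists_scalar (C₁_mem_centerT hH hh) W hW
  obtain ⟨c', hc'⟩ := exists_scalar (C₂_mem_centerT hH hh) W hW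
  have hLu := L_mulVec_raise hH hh hv hLv fun k => hc _ (raise_mem W hvW k)
  have hex : ∃ k, raise v k = 0 := by
    -- Degree `r + N + 1` exceeds the top level `N`.
    refine ⟨N + 1, ?_⟩
    by_contra hne
    have := le_of_mem_homog hH hh (raise_mem_homog hv _) hne
    omega
  obtain ⟨d, hd⟩ : ∃ d, Nat.find hex = d + 1 := by
    refine Nat.exists_eq_succ_of_ne_zero fun h0 => hv0 ?_
    have := Nat.find_spec hex
    rwa [h0, raise_zero] at this
  have hzero : ∀ k, raise v k = 0 ↔ d < k := by
    intro k
    constructor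
    · intro hk
      have := Nat.find_min' hex hk
      omega
    · intro hk
      exact raise_eq_zero_of_le (by omega) (Nat.find_spec hex)
  have hspan : ∀ w ∈ W, w ∈ Submodule.span ℂ (Set.range (raise v)) := by
    let S : Submodule (T h N M) (AttenuatedSpace h → ℂ) :=
      { toAddSubmonoid := (Submodule.span ℂ (Set.range (raise v))).toAddSubmonoid
        smul_mem' := fun t w hw => by
          refine smul_mem_span_of_string hH hh (fun k => R_mulVec_raise v k) ?_ hLu
            (fun k => zpow_ne_zero _ hq)
            (fun k => K_mulVec_of_mem hH hh (raise_mem_homog hv k)) t hw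
          rw [raise_zero]
          exact hLv }
    have hSW : S ≤ W := by
      have : Submodule.span ℂ (Set.range (raise v)) ≤ W.restrictScalars ℂ :=
        Submodule.span_le.2 (by rintro _ ⟨k, rfl⟩; exact raise_mem W hvW k)
      exact this
    have hS0 : S ≠ ⊥ := by
      refine S.ne_bot_iff.2 ⟨v, ?_, hv0⟩
      have : raise v 0 ∈ Submodule.span ℂ (Set.range (raise v)) :=
        Submodule.subset_span ⟨0, rfl⟩
      rwa [raise_zero] at this
    have hSe : S = W := (hatom.le_iff.1 hSW).resolve_left hS0
    intro w hw
    rw [← hSe] at hw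
    exact hw
  have hsupp : support W = Set.Ico r (r + (d + 1)) := by
    ext i
    rw [Set.mem_Ico]
    constructor
    · rintro ⟨-, w, hw, hiw⟩
      by_contra hi
      apply hiw
      have hle : Submodule.span ℂ (Set.range (raise v)) ≤
          LinearMap.ker (Matrix.mulVecLin (proj h i)) := by
        refine Submodule.span_le.2 ?_
        rintro _ ⟨k, rfl⟩
        rw [SetLike.mem_coe, LinearMap.mem_ker, Matrix.mulVecLin_apply]
        by_cases hk : d < k
        · rw [(hzero k).2 hk, Matrix.mulVec_zero]
        · exact proj_mulVec_of_ne (by omega) (raise_mem_homog hv k)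
      exact hle (hspan w hw)
    · rintro ⟨hi1, hi2⟩
      obtain ⟨k, rfl⟩ := Nat.exists_eq_add_of_le hi1
      have hne : raise v k ≠ 0 := fun h0 => by
        have := (hzero k).1 h0
        omega
      refine ⟨le_of_mem_homog hH hh (raise_mem_homog hv k) hne, _, raise_mem W hvW k, ?_⟩
      rwa [proj_mulVec_of_mem (raise_mem_homog hv k)]
  have hend : endpoint W = r := by
    rw [endpoint, hsupp]
    exact IsLeast.csInf_eq ⟨⟨le_rfl, by omega⟩, fun i hi => hi.1⟩
  have hdiam : diameter W = d := by
    rw [diameter, hsupp, ← Finset.coe_Ico, Set.ncard_coe_finset, Nat.card_Ico]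
    omega
  have htype : type W = (r, d) := by rw [type, hend, hdiam]
  have hcoeff : ladderCoeff (q F) (q F ^ ((N : ℤ) + M - r)) c (d + 1) = 0 := by
    have h1 := hLu d
    rw [(hzero (d + 1)).2 (by omega), Matrix.mulVec_zero] at h1
    exact (smul_eq_zero.1 h1.symm).resolve_right fun h0 => by
      have := (hzero d).1 h0
      omega
  have hcs : c = scalar₁ F N M (type W) := by
    rw [htype, scalar₁_eq]
    exact eq_of_ladderCoeff_eq_zero hq hq1 (q_pow_succ_ne_one d) hcoeff
  have hcs' : c' = scalar₂ F N M (type W) := by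
    -- On `v` the operators `R L` and `L R` are known: the first is zero and the second is the first
    -- ladder coefficient. This expresses `c'` through `c`.
    have h1 := hc' v hvW
    have h2 := hLu 0
    rw [← R_mulVec_raise, raise_zero, zero_add, ladderCoeff_succ hq hq1, ladderCoeff_zero] at h2
    rw [C₂_mulVec, K_mulVec_of_mem hH hh hv, Matrix.mulVec_smul, Matrix.mulVec_smul,
      K_mulVec_of_mem hH hh hv, hLv, smul_zero, Matrix.mulVec_zero, smul_zero, add_zero,
      Matrix.mulVec_smul, Matrix.mulVec_smul, h2] at h1
    simp only [smul_smul, ← sub_smul] at h1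
    have h3 := smul_left_injective ℂ hv0 h1
    rw [← h3, hcs, htype, scalar₁_eq, scalar₂]
    have e1 : q F ^ (2 * (N : ℤ) + 2 * M - 2 * r - d) =
        q F ^ ((N : ℤ) + M - r) * q F ^ ((N : ℤ) + M - r) * (q F ^ d)⁻¹ := by
      rw [← zpow_natCast, ← zpow_neg, ← zpow_add₀ hq, ← zpow_add₀ hq]
      congr 1
      ring
    rw [e1]
    have hx : q F ^ d ≠ 0 := pow_ne_zero _ hq
    field_simp
    ring
  refine ⟨v, hvW, hend ▸ hv, hLv, hdiam ▸ hzero, ?_, hcs ▸ hc, hcs' ▸ hc'⟩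
  rw [hend, hdiam, hsupp]

/-- The pairs `(R^k v, R^k v')` form a string with common coefficients, so `t` sends `(v, v')` into
their span. In each degree the two components of `t (v, v')` then carry the same coefficient, and
the two strings vanish at the same steps. -/
theorem smul_eq_zero_of_type_eq {W W' : Submodule (T h N M) (AttenuatedSpace h → ℂ)}
    {r d : ℕ} {c : ℂ} {v v' : AttenuatedSpace h → ℂ}
    (hvW : v ∈ W) (hvW' : v' ∈ W') (hv : v ∈ homog h r) (hv' : v' ∈ homog h r)
    (hLv : L h *ᵥ v = 0) (hLv' : L h *ᵥ v' = 0)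
    (hz : ∀ k, raise v k = 0 ↔ d < k) (hz' : ∀ k, raise v' k = 0 ↔ d < k)
    (hc : ∀ w ∈ W, C₁ h N M *ᵥ w = c • w) (hc' : ∀ w ∈ W', C₁ h N M *ᵥ w = c • w)
    (t : T h N M) (ht : t • v = 0) : t • v' = 0 := by
  have hq : q F ≠ 0 := q_ne_zero
  have hLu := L_mulVec_raise hH hh hv hLv fun k => hc _ (raise_mem W hvW k)
  have hLu' := L_mulVec_raise hH hh hv' hLv' fun k => hc' _ (raise_mem W' hvW' k)
  let u : ℕ → (AttenuatedSpace h → ℂ) × (AttenuatedSpace h → ℂ) :=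
    fun k => (raise v k, raise v' k)
  have hmem : t • u 0 ∈ Submodule.span ℂ (Set.range u) := by
    refine smul_mem_span_of_string hH hh
      (fun k => Prod.ext (R_mulVec_raise v k) (R_mulVec_raise v' k)) (Prod.ext ?_ ?_)
      (fun k => Prod.ext (hLu k) (hLu' k)) (fun k => zpow_ne_zero _ hq)
      (fun k => Prod.ext (K_mulVec_of_mem hH hh (raise_mem_homog hv k))
        (K_mulVec_of_mem hH hh (raise_mem_homog hv' k))) t (Submodule.subset_span ⟨0, rfl⟩)
    · change L h *ᵥ raise v 0 = 0
      rw [raise_zero, hLv]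
    · change L h *ᵥ raise v' 0 = 0
      rw [raise_zero, hLv']
  have hprop : ∀ i, ∀ e ∈ Submodule.span ℂ (Set.range u), ∃ b : ℂ,
      -- The subtraction truncates when `i < r`; this is harmless, since both projections are then
      -- zero and `b = 0` serves.
      proj h i *ᵥ e.1 = b • raise v (i - r) ∧ proj h i *ᵥ e.2 = b • raise v' (i - r) := by
    intro i e he
    induction he using Submodule.span_induction with
    | mem x hx =>
      obtain ⟨k, rfl⟩ := hx
      by_cases hi : r + k = i
      · subst hi
        refine ⟨1, ?_⟩
        rw [Nat.add_sub_cancel_left, one_smul, one_smul]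
        exact ⟨proj_mulVec_of_mem (raise_mem_homog hv k),
          proj_mulVec_of_mem (raise_mem_homog hv' k)⟩
      · refine ⟨0, ?_⟩
        rw [zero_smul, zero_smul]
        exact ⟨proj_mulVec_of_ne hi (raise_mem_homog hv k),
          proj_mulVec_of_ne hi (raise_mem_homog hv' k)⟩
    | zero => exact ⟨0, by simp, by simp⟩
    | add x y _ _ hx hy =>
      obtain ⟨b, h1, h2⟩ := hx
      obtain ⟨b', h3, h4⟩ := hy
      exact ⟨b + b', by rw [Prod.fst_add, Matrix.mulVec_add, h1, h3, add_smul],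
        by rw [Prod.snd_add, Matrix.mulVec_add, h2, h4, add_smul]⟩
    | smul a x _ hx =>
      obtain ⟨b, h1, h2⟩ := hx
      exact ⟨a * b, by rw [Prod.smul_fst, Matrix.mulVec_smul, h1, smul_smul],
        by rw [Prod.smul_snd, Matrix.mulVec_smul, h2, smul_smul]⟩
  refine eq_zero_of_proj_mulVec fun i => ?_
  obtain ⟨b, h1, h2⟩ := hprop i _ hmem
  change proj h i *ᵥ (t • raise v 0) = _ at h1
  change proj h i *ᵥ (t • raise v' 0) = _ at h2
  rw [raise_zero, ht, Matrix.mulVec_zero] at h1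
  rw [raise_zero] at h2
  rw [h2]
  rcases smul_eq_zero.1 h1.symm with hb | hb
  · rw [hb, zero_smul]
  · rw [(hz' _).2 ((hz _).1 hb), smul_zero]

theorem nonempty_linearEquiv_of_type_eq {W W' : Submodule (T h N M) (AttenuatedSpace h → ℂ)}
    (hW : IsSimpleModule (T h N M) W) (hW' : IsSimpleModule (T h N M) W')
    (htype : type W = type W') : Nonempty (W ≃ₗ[T h N M] W') := by
  obtain ⟨v, hvW, hv, hLv, hz, -, hc, -⟩ := exists_string hH hh W hW
  obtain ⟨v', hvW', hv', hLv', hz', -, hc', -⟩ := exists_string hH hh W' hW'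
  have hr : endpoint W = endpoint W' := congrArg Prod.fst htype
  have hd : diameter W = diameter W' := congrArg Prod.snd htype
  rw [← hr] at hv'
  rw [← hd] at hz'
  rw [← htype] at hc'
  have hv0 : v ≠ 0 := fun h0 => by
    have := (hz 0).1 (by rwa [raise_zero])
    omega
  have hv0' : v' ≠ 0 := fun h0 => by
    have := (hz' 0).1 (by rwa [raise_zero])
    omega
  exact nonempty_linearEquiv_of_smul_eq_zero_iff hW hW' hvW hvW' hv0 hv0' fun t =>
    ⟨smul_eq_zero_of_type_eq hH hh hvW hvW' hv hv' hLv hLv' hz hz' hc hc' t,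
      smul_eq_zero_of_type_eq hH hh hvW' hvW hv' hv hLv' hLv hz' hz hc' hc t⟩

theorem support_subset_of_linearEquiv {W W' : Submodule (T h N M) (AttenuatedSpace h → ℂ)}
    (f : W ≃ₗ[T h N M] W') : support W ⊆ support W' := by
  rintro i ⟨hi, w, hw, hiw⟩
  exact ⟨hi, f ⟨w, hw⟩, (f ⟨w, hw⟩).2,
    smul_linearEquiv_ne_zero f (⟨proj h i, proj_mem_T hH hh i⟩ : T h N M) ⟨w, hw⟩ hiw⟩

theorem type_eq_of_linearEquiv {W W' : Submodule (T h N M) (AttenuatedSpace h → ℂ)}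
    (f : W ≃ₗ[T h N M] W') : type W = type W' := by
  have : support W = support W' := (support_subset_of_linearEquiv hH hh f).antisymm
    (support_subset_of_linearEquiv hH hh f.symm)
  rw [type, type, endpoint, endpoint, diameter, diameter, this]

end

section

variable {F H : Type*} [Field F] [AddCommGroup H] [Module F H] {h : Submodule F H}
variable [FiniteDimensional F H] [Finite F] {N M : ℕ}

/-! ### Semisimplicity of the standard module -/

section Semisimple

variable (hH : Module.finrank F H = N + M) (hh : Module.finrank F h = M)
include hH hh

theorem conjTranspose_mem_T {A : Matrix (AttenuatedSpace h) (AttenuatedSpace h) ℂ}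
    (hA : A ∈ T h N M) : Aᴴ ∈ T h N M := by
  have hR : (R h)ᴴ = L h := by
    ext x y
    simp [R, L, Matrix.conjTranspose_apply, apply_ite]
  have hK : (K h N M)ᴴ = K h N M := by
    rw [K_eq_diagonal (dim_le hH hh), Matrix.diagonal_conjTranspose]
    congr 1
    ext x
    simp [q]
  induction hA using Algebra.adjoin_induction with
  | mem A hA =>
    simp only [Set.mem_insert_iff, Set.mem_singleton_iff] at hA
    rcases hA with rfl | rfl | rfl | rfl
    · rw [hR]; exact L_mem_T h N M
    · rw [← hR, Matrix.conjTranspose_conjTranspose]; exact R_mem_T h N M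
    · rw [hK]; exact K_mem_T h N M
    · rw [Matrix.conjTranspose_nonsing_inv, hK]; exact K_inv_mem_T h N M
  | algebraMap c =>
    rw [Matrix.algebraMap_eq_diagonal, Matrix.diagonal_conjTranspose]
    exact (T h N M).algebraMap_mem (star c)
  | add A B _ _ hA hB => rw [Matrix.conjTranspose_add]; exact add_mem hA hB
  | mul A B _ _ hA hB => rw [Matrix.conjTranspose_mul]; exact mul_mem hB hA

/-- Closure of `T` under conjugate transpose makes the orthogonal complement of a submodule again a
submodule. -/
theorem isSemisimpleModule : IsSemisimpleModule (T h N M) (AttenuatedSpace h → ℂ) := by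
  refine @IsSemisimpleModule.mk _ _ _ _ _ ⟨fun W => ?_⟩
  let e := (WithLp.linearEquiv 2 ℂ (AttenuatedSpace h → ℂ)).symm
  let U : Submodule ℂ (EuclideanSpace ℂ (AttenuatedSpace h)) :=
    (W.restrictScalars ℂ).map e.toLinearMap
  have hmem : ∀ v, e v ∈ Uᗮ ↔ ∀ w ∈ W, v ⬝ᵥ star w = 0 := by
    intro v
    rw [Submodule.mem_orthogonal]
    constructor
    · intro hv w hw
      exact hv (e w) ⟨w, hw, rfl⟩
    · rintro hv _ ⟨w, hw, rfl⟩
      exact hv w hw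
  let W' : Submodule (T h N M) (AttenuatedSpace h → ℂ) :=
    { toAddSubmonoid := (Uᗮ.comap e.toLinearMap).toAddSubmonoid
      smul_mem' := fun t v hv => by
        have hv' := (hmem v).1 hv
        refine (hmem _).2 fun w hw => ?_
        have h1 := hv' _ (mulVec_mem W (conjTranspose_mem_T hH hh t.2) hw)
        rw [Matrix.star_mulVec, Matrix.conjTranspose_conjTranspose, dotProduct_comm,
          ← Matrix.dotProduct_mulVec, dotProduct_comm] at h1
        exact h1 }
  have hcompl : IsCompl U Uᗮ := U.isCompl_orthogonal
  refine ⟨W', ?_⟩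
  rw [isCompl_iff, Submodule.disjoint_def, codisjoint_iff, eq_top_iff]
  constructor
  · intro w hw hw'
    have := (Submodule.disjoint_def.1 hcompl.disjoint) (e w) ⟨w, hw, rfl⟩ hw'
    exact e.map_eq_zero_iff.1 this
  · intro w _
    have : e w ∈ U ⊔ Uᗮ := by rw [hcompl.sup_eq_top]; trivial
    obtain ⟨_, ⟨a, ha, rfl⟩, b, hb, hab⟩ := Submodule.mem_sup.1 this
    refine Submodule.mem_sup.2 ⟨a, ha, e.symm b, ?_, ?_⟩
    · change e (e.symm b) ∈ Uᗮ
      rwa [e.apply_symm_apply]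
    · apply e.injective
      rw [map_add, e.apply_symm_apply]
      exact hab

/-- Matrices agreeing on every simple submodule are equal. -/
theorem eq_of_mulVec_eq_on_simple {A B : Matrix (AttenuatedSpace h) (AttenuatedSpace h) ℂ}
    (hAB : ∀ W : Submodule (T h N M) (AttenuatedSpace h → ℂ), IsSimpleModule (T h N M) W →
      ∀ w ∈ W, A *ᵥ w = B *ᵥ w) : A = B := by
  have := isSemisimpleModule hH hh
  have htop := IsSemisimpleModule.sSup_simples_eq_top (T h N M) (AttenuatedSpace h → ℂ)
  have key : ∀ v : AttenuatedSpace h → ℂ, A *ᵥ v = B *ᵥ v := by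
    intro v
    have hv : v ∈ sSup {m : Submodule (T h N M) (AttenuatedSpace h → ℂ) |
        IsSimpleModule (T h N M) m} := by rw [htop]; trivial
    rw [sSup_eq_iSup'] at hv
    induction hv using Submodule.iSup_induction' with
    | mem W w hw => exact hAB W.1 W.2 w hw
    | zero => rw [Matrix.mulVec_zero, Matrix.mulVec_zero]
    | add x y _ _ hx hy => rw [Matrix.mulVec_add, Matrix.mulVec_add, hx, hy]
  exact Matrix.mulVec_injective (funext key)

end Semisimple

/-- A subalgebra of functions that separates the points of a finite set realizes every function
on that set. -/
theorem exists_mem_eqOn_of_separates {X : Type*} (A : Subalgebra ℂ (X → ℂ)) (S : Finset X)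
    (hA : ∀ s ∈ S, ∀ t ∈ S, s ≠ t → ∃ g ∈ A, g s ≠ g t) (f : X → ℂ) :
    ∃ g ∈ A, ∀ s ∈ S, g s = f s := by
  classical
  have hsep : ∀ s t, ∃ g ∈ A, s ∈ S → t ∈ S → s ≠ t → g s = 1 ∧ g t = 0 := by
    intro s t
    by_cases hst : s ∈ S ∧ t ∈ S ∧ s ≠ t
    · obtain ⟨g, hg, hne⟩ := hA s hst.1 t hst.2.1 hst.2.2
      -- The affine normalization of `g` with value `1` at `s` and `0` at `t`; products of these
      -- over `t` are the Lagrange basis functions.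
      refine ⟨(g s - g t)⁻¹ • (g - algebraMap ℂ (X → ℂ) (g t)),
        A.smul_mem (sub_mem hg (A.algebraMap_mem _)) _, fun _ _ _ => ⟨?_, ?_⟩⟩
      · simpa using inv_mul_cancel₀ (sub_ne_zero.2 hne)
      · simp
    · exact ⟨0, zero_mem _, fun h1 h2 h3 => absurd ⟨h1, h2, h3⟩ hst⟩
  choose δ hδ hδ' using hsep
  refine ⟨∑ s ∈ S, f s • ∏ t ∈ S.erase s, δ s t,
    sum_mem fun s _ => A.smul_mem (prod_mem fun t _ => hδ s t) _, fun s hs => ?_⟩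
  rw [Finset.sum_apply, Finset.sum_eq_single_of_mem s hs]
  · rw [Pi.smul_apply, Finset.prod_apply, Finset.prod_eq_one, smul_eq_mul, mul_one]
    intro t ht
    exact (hδ' s t hs (Finset.mem_of_mem_erase ht) (Finset.ne_of_mem_erase ht).symm).1
  · intro t ht hts
    have h0 : ∏ c ∈ S.erase t, δ t c s = 0 :=
      Finset.prod_eq_zero (Finset.mem_erase.2 ⟨hts.symm, hs⟩) (hδ' t s ht hs hts).2
    rw [Pi.smul_apply, Finset.prod_apply, h0, smul_zero]

/-! ### The center is generated by `C₁` and `C₂` -/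

section Center

variable (hH : Module.finrank F H = N + M) (hh : Module.finrank F h = M)
include hH hh

/-- Only finitely many types occur, as the interpolation in `adjoin_eq_centerT` requires. -/
theorem type_mem (W : Submodule (T h N M) (AttenuatedSpace h → ℂ))
    (hW : IsSimpleModule (T h N M) W) :
    type W ∈ Finset.range (N + 1) ×ˢ Finset.range (N + 1) := by
  obtain ⟨v, -, -, -, -, hs, -⟩ := exists_string hH hh W hW
  have hmem : endpoint W + diameter W ∈ support W := by
    rw [hs]
    exact ⟨by omega, by omega⟩
  have := hmem.1
  rw [type, Finset.mem_product, Finset.mem_range, Finset.mem_range]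
  exact ⟨by simp only; omega, by simp only; omega⟩

/-- A central element acts on simple modules of the same type as the same scalar. -/
theorem exists_scalar_of_type {A : Matrix (AttenuatedSpace h) (AttenuatedSpace h) ℂ}
    (hA : A ∈ centerT h N M) (t : ℕ × ℕ) :
    ∃ c : ℂ, ∀ W : Submodule (T h N M) (AttenuatedSpace h → ℂ),
      IsSimpleModule (T h N M) W → type W = t → ∀ w ∈ W, A *ᵥ w = c • w := by
  by_cases hex : ∃ W : Submodule (T h N M) (AttenuatedSpace h → ℂ),
      IsSimpleModule (T h N M) W ∧ type W = t
  · obtain ⟨W₀, hW₀, ht₀⟩ := hex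
    obtain ⟨c, hc⟩ := exists_scalar hA W₀ hW₀
    refine ⟨c, fun W hW ht w hw => ?_⟩
    obtain ⟨f⟩ := nonempty_linearEquiv_of_type_eq hH hh hW hW₀ (ht.trans ht₀.symm)
    have hsmul : ∀ v, (⟨A, (mem_centerT.1 hA).1⟩ - algebraMap ℂ (T h N M) c : T h N M) • v =
        A *ᵥ v - c • v := fun v => by
      rw [sub_smul, algebraMap_smul]
      rfl
    by_contra hne
    -- The element `A - c` of `T` annihilates `W₀`, so it annihilates the isomorphic module `W`.
    refine smul_linearEquiv_ne_zero f
      (⟨A, (mem_centerT.1 hA).1⟩ - algebraMap ℂ (T h N M) c) ⟨w, hw⟩ ?_ ?_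
    · rw [hsmul]
      exact sub_ne_zero.2 hne
    · rw [hsmul, hc _ (f ⟨w, hw⟩).2, sub_self]
  · exact ⟨0, fun W hW ht => absurd ⟨W, hW, ht⟩ hex⟩

theorem adjoin_eq_centerT : Algebra.adjoin ℂ {C₁ h N M, C₂ h N M} = centerT h N M := by
  refine le_antisymm (Algebra.adjoin_le ?_) fun A hA => ?_
  · rintro B (rfl | rfl)
    exacts [C₁_mem_centerT hH hh, C₂_mem_centerT hH hh]
  choose f hf using exists_scalar_of_type hH hh hA
  -- The functions of the type realized as scalars by polynomials in `C₁` and `C₂`. They contain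
  -- `scalar₁` and `scalar₂`, hence separate points, and so some member agrees with the scalars `f`
  -- of `A` on all types that occur.
  let 𝔉 : Subalgebra ℂ (ℕ × ℕ → ℂ) :=
    { carrier := {g | ∃ B ∈ Algebra.adjoin ℂ {C₁ h N M, C₂ h N M},
        ∀ W : Submodule (T h N M) (AttenuatedSpace h → ℂ), IsSimpleModule (T h N M) W →
          ∀ w ∈ W, B *ᵥ w = g (type W) • w}
      mul_mem' := by
        rintro g g' ⟨B, hB, hg⟩ ⟨B', hB', hg'⟩
        refine ⟨B * B', mul_mem hB hB', fun W hW w hw => ?_⟩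
        rw [← Matrix.mulVec_mulVec, hg' W hW w hw, Matrix.mulVec_smul, hg W hW w hw, smul_smul,
          mul_comm, Pi.mul_apply]
      add_mem' := by
        rintro g g' ⟨B, hB, hg⟩ ⟨B', hB', hg'⟩
        refine ⟨B + B', add_mem hB hB', fun W hW w hw => ?_⟩
        rw [Matrix.add_mulVec, hg W hW w hw, hg' W hW w hw, Pi.add_apply, add_smul]
      algebraMap_mem' := fun c => by
        refine ⟨algebraMap ℂ _ c, Subalgebra.algebraMap_mem _ c, fun W hW w hw => ?_⟩
        rw [Algebra.algebraMap_eq_smul_one, Matrix.smul_mulVec, Matrix.one_mulVec]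
        rfl }
  have h1 : scalar₁ F N M ∈ 𝔉 := ⟨C₁ h N M, Algebra.subset_adjoin (by simp), fun W hW w hw => by
    obtain ⟨v, -, -, -, -, -, hc, -⟩ := exists_string hH hh W hW
    exact hc w hw⟩
  have h2 : scalar₂ F N M ∈ 𝔉 := ⟨C₂ h N M, Algebra.subset_adjoin (by simp), fun W hW w hw => by
    obtain ⟨v, -, -, -, -, -, -, hc⟩ := exists_string hH hh W hW
    exact hc w hw⟩
  obtain ⟨g, ⟨B, hB, hg⟩, hgf⟩ := exists_mem_eqOn_of_separates 𝔉
    (Finset.range (N + 1) ×ˢ Finset.range (N + 1)) (fun s _ t _ hst => by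
      by_contra hcon
      push Not at hcon
      exact hst (scalars_injective (hcon _ h1) (hcon _ h2))) f
  have hAB : A = B := eq_of_mulVec_eq_on_simple hH hh fun W hW w hw => by
    rw [hf _ W hW rfl w hw, hg W hW w hw, hgf _ (type_mem hH hh W hW)]
  rwa [hAB]

end Center

end

end AttenuatedSpace

end

open AttenuatedSpace in
theorem mainTheorem5 {F H : Type*} [Field F] [Finite F] [AddCommGroup H] [Module F H]
    [FiniteDimensional F H] (N M : ℕ) (hN : 0 < N) (hM : 0 < M)
    (hH : Module.finrank F H = N + M)
    (h : Submodule F H) (hh : Module.finrank F h = M) :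
    C₁ h N M ∈ centerT h N M ∧ C₂ h N M ∈ centerT h N M ∧
    Algebra.adjoin ℂ {C₁ h N M, C₂ h N M} = centerT h N M ∧
    (∀ W : Submodule (T h N M) (AttenuatedSpace h → ℂ), IsSimpleModule (T h N M) W →
      ∀ w ∈ W,
        C₁ h N M *ᵥ w = scalar₁ F N M (type W) • w ∧
        C₂ h N M *ᵥ w = scalar₂ F N M (type W) • w) ∧
    (∀ W W' : Submodule (T h N M) (AttenuatedSpace h → ℂ),
      IsSimpleModule (T h N M) W → IsSimpleModule (T h N M) W' →
        (type W = type W' ↔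
          scalar₁ F N M (type W) = scalar₁ F N M (type W') ∧
          scalar₂ F N M (type W) = scalar₂ F N M (type W')) ∧
        (Nonempty (W ≃ₗ[T h N M] W') ↔ type W = type W')) := by
  refine ⟨C₁_mem_centerT hH hh, C₂_mem_centerT hH hh, adjoin_eq_centerT hH hh,
    fun W hW w hw => ?_, fun W W' hW hW' => ⟨⟨fun ht => ?_, fun hs => ?_⟩, ⟨?_, fun ht => ?_⟩⟩⟩
  · obtain ⟨v, -, -, -, -, -, h1, h2⟩ := exists_string hH hh W hW
    exact ⟨h1 w hw, h2 w hw⟩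
  · rw [ht]
    exact ⟨rfl, rfl⟩
  · exact scalars_injective hs.1 hs.2
  · rintro ⟨f⟩
    exact type_eq_of_linearEquiv hH hh f
  · exact nonempty_linearEquiv_of_type_eq hH hh hW hW' ht
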